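/- Let $\lambda>0$, $0<p_A<1$, $0\le q\le 1$, $\alpha>2$ and $v\ge 0$. Let $\Phi$ (the devices) be a homogeneous Poisson point process of intensity $\lambda$ on $\mathbb{R}^2$. Independently of $\Phi$ and of the other devices, each device $z$ carries three independent marks: a cached file, which is $A$ with probability $p_A$ and $B$ with probability $1-p_A$; an activity indicator $t_z$, equal to $1$ with probability $q$ and to $0$ otherwise; and a fading gain $h_z\sim\exp(1)$. Let $\Phi_A$ be the set of devices that cache $A$. Let $R_1$ be the distance from location 1, the point $(-v,0)$, to the closest device, and let $\mathcal{Y}$ be the event that this closest device caches $B$. On $\mathcal{Y}$ let $R_2$ be the distance from the origin to the closest device of $\Phi_A$, let $\mathcal{C}_1$ be the closed disc of radius $R_1$ around $(-v,0)$, let $\mathcal{C}_2$ be the closed disc of radius $R_2$ around the origin, and let $$I_3=\sum_{z\in\Phi_A\setminus(\mathcal{C}_1\cup\mathcal{C}_2)}t_z h_z\|z\|^{-\alpha}.$$ Then, conditionally on $\mathcal{Y}$, the sum $I_3$ converges almost surely, and for almost every $(r_1,r_2)$ with respect to the joint law of $(R_1,R_2)$ given $\mathcal{Y}$, the Laplace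 transform of the conditional distribution of $I_3$ given $\mathcal{Y}$, $R_1=r_1$, $R_2=r_2$ is, for all $s>0$, $$\mathcal{L}_{I_3|R_1,R_2}(s|r_1,r_2)=\exp\left(-p_A q\lambda\int_{r_2}^{\infty}\frac{2\pi r\,\mathrm{d}r}{1+r^{\alpha}/s}\right)\exp\big(p_A q\lambda\,\mathcal{B}(r_1,r_2,v)\big),$$ where, with $f(r,r_1)=\cos^{-1}\left(\frac{r^2+v^2-r_1^2}{2rv}\right)$, $$\mathcal{B}(r_1,r_2,v)=\begin{cases}\displaystyle\int_{v-r_1}^{v+r_1}\frac{2f(r,r_1)\,r\,\mathrm{d}r}{1+r^{\alpha}/s}, & v\ge r_1+r_2,\\[2ex]\displaystyle\int_{r_2}^{v+r_1}\frac{2f(r,r_1)\,r\,\mathrm{d}r}{1+r^{\alpha}/s}, & r_2-r_1<v<r_1+r_2,\\[2ex] 0, & v\le r_2-r_1.\end{cases}$$ -/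

import Mathlib

open MeasureTheory ProbabilityTheory Set
open scoped NNReal ENNReal unitInterval

noncomputable section

namespace D2DCaching

/-- The Euclidean plane in which devices and users live. -/
abbrev Plane : Type := EuclideanSpace ℝ (Fin 2)

/-- The two portions of the larger file; every device caches exactly one of them. -/
inductive FilePortion : Type
  | A
  | B

instance : MeasurableSpace FilePortion := ⊤

variable {Ω : Type*} [MeasurableSpace Ω]

/-- `X 0, X 1, …` enumerates the points of a homogeneous Poisson point process of intensity `lam`
on the plane: the number of points in a Borel set of finite area has the Poisson law with mean
`lam * area`, and the numbers of points in disjoint such sets are independent. -/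
structure IsHomogeneousPPP (P : Measure Ω) (lam : ℝ≥0) (X : ℕ → Ω → Plane) : Prop where
  measurable : ∀ n, Measurable (X n)
  hasLaw_count : ∀ S : Set Plane, MeasurableSet S → volume S ≠ ∞ →
    HasLaw (fun ω => {n | X n ω ∈ S}.encard)
      ((poissonMeasure (lam * (volume S).toNNReal)).map (Nat.cast : ℕ → ℕ∞)) P
  indep_count : ∀ (k : ℕ) (S : Fin k → Set Plane), (∀ i, MeasurableSet (S i)) →
    (∀ i, volume (S i) ≠ ∞) → Pairwise (fun i j => Disjoint (S i) (S j)) →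
    iIndepFun (fun i ω => {n | X n ω ∈ S i}.encard) P

/-- The random quantities attached to the devices: location, cached file portion, activity
indicator (`1` if the device is active as an interferer, `0` otherwise) and fading gain. -/
structure Network (Ω : Type*) where
  location : ℕ → Ω → Plane
  file : ℕ → Ω → FilePortion
  activity : ℕ → Ω → ℝ
  fading : ℕ → Ω → ℝ

namespace Network

/-- The triple (file portion, activity, fading) of a device. -/
def mark (N : Network Ω) (n : ℕ) (ω : Ω) : FilePortion × ℝ × ℝ :=
  (N.file n ω, N.activity n ω, N.fading n ω)

/-- The probabilistic model: the locations form a homogeneous Poisson point process of intensity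
`lam`; the marks of the devices are i.i.d. and independent of the locations; within a mark the
three components are independent, the file is `A` with probability `p` and `B` with probability
`1 - p`, the activity is `1` with probability `q` and `0` otherwise, and the fading is
exponential with mean one. -/
structure IsModel (N : Network Ω) (P : Measure Ω) (lam : ℝ≥0) (p q : I) : Prop where
  ppp : IsHomogeneousPPP P lam N.location
  measurable_mark : ∀ n, Measurable (N.mark n)
  hasLaw_mark : ∀ n, HasLaw (N.mark n)
    ((bernoulliMeasure FilePortion.A FilePortion.B p).prod
      ((bernoulliMeasure (1 : ℝ) 0 q).prod (expMeasure 1))) P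
  iIndepFun_mark : iIndepFun N.mark P
  indepFun_location_mark :
    IndepFun (fun ω n => N.location n ω) (fun ω n => N.mark n ω) P

/-- The initial location `(-v, 0)` of the user; the final location is the origin. -/
def loc1 (v : ℝ) : Plane := !₂[-v, 0]

/-- Subcase `Y`: the device closest to location 1 caches file `B` (file 1 is `B`). -/
def subcaseY (N : Network Ω) (v : ℝ) : Set Ω :=
  {ω | ∃ n, N.file n ω = FilePortion.B ∧
    ∀ m, dist (N.location n ω) (loc1 v) ≤ dist (N.location m ω) (loc1 v)}

/-- `R₁`, the distance from location 1 to the closest device (its file is, by definition,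
file 1). -/
def R1 (N : Network Ω) (v : ℝ) (ω : Ω) : ℝ :=
  Metric.infDist (loc1 v) (range fun n => N.location n ω)

/-- `R₂` in subcase `Y`, where file 2 is `A`: the distance from location 2, the origin, to the
closest device that caches `A`. -/
def R2 (N : Network Ω) (ω : Ω) : ℝ :=
  Metric.infDist (0 : Plane) {x | ∃ n, N.file n ω = FilePortion.A ∧ N.location n ω = x}

/-- The devices that cache `A` and lie outside `C₁ ∪ C₂`, where `C₁` is the closed disc of radius
`R₁` around location 1 and `C₂` the closed disc of radius `R₂` around the origin. -/
def interferersA (N : Network Ω) (v : ℝ) (ω : Ω) : Set ℕ :=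
  {n | N.file n ω = FilePortion.A ∧
    N.location n ω ∉ Metric.closedBall (loc1 v) (N.R1 v ω) ∪ Metric.closedBall 0 (N.R2 ω)}

/-- The power that the origin receives from device `n` if `n` is one of the interferers caching
`A` outside `C₁ ∪ C₂`, and `0` otherwise. -/
def I3term (N : Network Ω) (α v : ℝ) (ω : Ω) : ℕ → ℝ :=
  (N.interferersA v ω).indicator
    fun n => N.activity n ω * N.fading n ω * ‖N.location n ω‖ ^ (-α)

/-- The interference `I₃`. -/
def I3 (N : Network Ω) (α v : ℝ) (ω : Ω) : ℝ := ∑' n, N.I3term α v ω n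

end Network

/-- The Laplace transform at `s` of the regular conditional distribution of `J` given `R = r`. -/
def condLaplace (μ : Measure Ω) [IsFiniteMeasure μ] (J : Ω → ℝ) (R : Ω → ℝ × ℝ) (s : ℝ)
    (r : ℝ × ℝ) : ℝ :=
  ∫ x, Real.exp (-s * x) ∂(condDistrib J R μ r)

/-- Half the angle under which the arc of the circle of radius `r` around the origin that lies in
`C₁` is seen from the origin. -/
def f (v r r1 : ℝ) : ℝ := Real.arccos ((r ^ 2 + v ^ 2 - r1 ^ 2) / (2 * r * v))

open Classical in
/-- The integral over `C₁ \ C₂`, for disjoint, intersecting and engulfed circles. -/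
def calB (α s r1 r2 v : ℝ) : ℝ :=
  if r1 + r2 ≤ v then
    ∫ r in (v - r1)..(v + r1), 2 * f v r r1 * r / (1 + r ^ α / s)
  else if r2 - r1 < v then
    ∫ r in r2..(v + r1), 2 * f v r r1 * r / (1 + r ^ α / s)
  else 0

end D2DCaching

end

open Filter Topology

namespace D2DCaching

/-! ### Infinite products of factors in `[0, 1]` -/

/-! For a deterministic region `K`, the marked points over `K` are independent of those off `K`, and
the Laplace functional of the marked Poisson process gives the interference from outside `K` the
Laplace transform `laplaceOutside`, that is, exp(-p q λ ∫ 1/(1 + ‖x‖^α/s)) over the complement of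
`K`. The integrand is the mean loss 1 - E exp(-s h ‖x‖^(-α)) for an exponential gain `h`; the factor
p q is the probability that a device caches `A` and is active.

The discs are random, so this independence does not apply to them directly. The distances are
therefore rounded up to a grid of mesh `δ`. On one grid cell the rounded discs are fixed, and the
cell, intersected with a discretized subcase `Y`, is built by set differences from void events that
concern only points inside these discs. This gives the identity on each cell (`setLIntegral_cell`),
and summing over the cells gives `setLIntegral_approxY`. Letting `δ` tend to 0 yields
`setLIntegral_subcaseY`: on `Y`, exp(-s I₃) and `laplaceOutside` have the same integral against
every bounded continuous function of the distances.

Such test functions determine the conditional Laplace transform almost everywhere for each `s`.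
Rational `s` and continuity give one null set for all `s` (`condLaplace_ae_eq_forall`). Finally,
polar coordinates express the planar integral as the integral off `C₂` minus that over `C₁ \ C₂`,
and the latter is `calB` (`setIntegral_compl_discs`). -/

/-- The infinite product of a sequence of factors in `[0, 1]`, as the infimum of the partial
products. -/
noncomputable def expProd (u : ℕ → ℝ≥0∞) : ℝ≥0∞ := ⨅ k, ∏ n ∈ Finset.range k, u n

lemma prod_range_antitone {u : ℕ → ℝ≥0∞} (hu : ∀ n, u n ≤ 1) :
    Antitone fun k => ∏ n ∈ Finset.range k, u n := by
  refine antitone_nat_of_succ_le fun k => ?_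
  rw [Finset.prod_range_succ]
  exact mul_le_of_le_one_right' (hu k)

lemma tendsto_expProd {u : ℕ → ℝ≥0∞} (hu : ∀ n, u n ≤ 1) :
    Tendsto (fun k => ∏ n ∈ Finset.range k, u n) atTop (𝓝 (expProd u)) :=
  tendsto_atTop_iInf (prod_range_antitone hu)

lemma expProd_le_one (u : ℕ → ℝ≥0∞) : expProd u ≤ 1 :=
  (iInf_le _ 0).trans (by simp)

lemma expProd_mul {u v : ℕ → ℝ≥0∞} (hu : ∀ n, u n ≤ 1) (hv : ∀ n, v n ≤ 1) :
    expProd (fun n => u n * v n) = expProd u * expProd v := by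
  refine tendsto_nhds_unique (tendsto_expProd fun n => mul_le_one' (hu n) (hv n)) ?_
  simp_rw [Finset.prod_mul_distrib]
  exact ENNReal.Tendsto.mul (tendsto_expProd hu)
    (.inr ((expProd_le_one v).trans_lt ENNReal.one_lt_top).ne) (tendsto_expProd hv)
    (.inr ((expProd_le_one u).trans_lt ENNReal.one_lt_top).ne)

lemma expProd_one : expProd (fun _ => 1) = 1 := by simp [expProd]

lemma expProd_prod {ι : Type*} (s : Finset ι) {u : ι → ℕ → ℝ≥0∞} (hu : ∀ i n, u i n ≤ 1) :
    expProd (fun n => ∏ i ∈ s, u i n) = ∏ i ∈ s, expProd (u i) := by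
  classical
  induction s using Finset.induction_on with
  | empty => simp [expProd_one]
  | insert i s hi ih =>
    simp_rw [Finset.prod_insert hi]
    rw [expProd_mul (hu i) fun n => Finset.prod_le_one' fun j _ => hu j n, ih]

lemma expProd_eq_finset_prod {u : ℕ → ℝ≥0∞} (hu : ∀ n, u n ≤ 1) (s : Finset ℕ)
    (hs : ∀ n ∉ s, u n = 1) : expProd u = ∏ n ∈ s, u n := by
  refine tendsto_nhds_unique (tendsto_expProd hu) ?_
  refine tendsto_const_nhds.congr' ?_
  obtain ⟨K, hK⟩ := s.exists_nat_subset_range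
  filter_upwards [eventually_ge_atTop K] with k hk
  exact Finset.prod_subset (hK.trans (Finset.range_mono hk)) fun n _ hn => hs n hn

/-- Once the two infima are swapped only finite products remain, and these pass to the limit because
every factor is at most 1. -/
lemma expProd_iInf {u : ℕ → ℕ → ℝ≥0∞} (hu : ∀ k n, u k n ≤ 1) (hanti : ∀ n, Antitone (u · n)) :
    ⨅ k, expProd (u k) = expProd fun n => ⨅ k, u k n := by
  unfold expProd
  rw [iInf_comm]
  refine iInf_congr fun K => ?_
  refine tendsto_nhds_unique (tendsto_atTop_iInf fun k l hkl =>
    Finset.prod_le_prod' fun n _ => hanti n hkl) ?_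
  have h (s : Finset ℕ) : Tendsto (fun k => ∏ n ∈ s, u k n) atTop (𝓝 (∏ n ∈ s, ⨅ k, u k n)) := by
    classical
    induction s using Finset.induction_on with
    | empty => simp
    | insert i s hi ih =>
      simp_rw [Finset.prod_insert hi]
      have h1 : ⨅ k, u k i ≠ ∞ := ((iInf_le _ 0).trans (hu 0 i)).trans_lt ENNReal.one_lt_top |>.ne
      have h2 : ∏ n ∈ s, ⨅ k, u k n ≠ ∞ :=
        ENNReal.prod_ne_top fun n _ =>
          (((iInf_le _ 0).trans (hu 0 n)).trans_lt ENNReal.one_lt_top).ne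
      exact ENNReal.Tendsto.mul (tendsto_atTop_iInf (hanti i)) (.inr h2) ih (.inr h1)
  exact h _

lemma expProd_eq_zero {u : ℕ → ℝ≥0∞} {n : ℕ} (hn : u n = 0) : expProd u = 0 := by
  refine le_antisymm ((iInf_le _ (n + 1)).trans ?_) zero_le
  rw [Finset.prod_eq_zero (Finset.self_mem_range_succ n) hn]

lemma expProd_ofReal_exp {x : ℕ → ℝ} (hx : ∀ n, 0 ≤ x n) (hs : Summable x) :
    expProd (fun n => ENNReal.ofReal (Real.exp (-x n))) =
      ENNReal.ofReal (Real.exp (-∑' n, x n)) := by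
  refine tendsto_nhds_unique (tendsto_expProd fun n => ?_) ?_
  · simpa using hx n
  · simp_rw [← ENNReal.ofReal_prod_of_nonneg (fun n _ => (Real.exp_pos (-x n)).le),
      ← Real.exp_sum, Finset.sum_neg_distrib]
    exact (ENNReal.continuous_ofReal.tendsto _).comp
      ((Real.continuous_exp.tendsto _).comp hs.hasSum.tendsto_sum_nat.neg)

lemma measurable_expProd {Ω : Type*} [MeasurableSpace Ω] {u : ℕ → Ω → ℝ≥0∞}
    (hu : ∀ n, Measurable (u n)) : Measurable fun ω => expProd fun n => u n ω :=
  Measurable.iInf fun _ => Finset.measurable_prod _ fun n _ => hu n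

/-- Monotone convergence for a decreasing sequence; it applies because the empty product 1 is
integrable. -/
lemma lintegral_expProd {Ω : Type*} [MeasurableSpace Ω] {P : Measure Ω} [IsProbabilityMeasure P]
    {u : ℕ → Ω → ℝ≥0∞} (hm : ∀ n, Measurable (u n)) (hu : ∀ n ω, u n ω ≤ 1) :
    ∫⁻ ω, expProd (fun n => u n ω) ∂P = ⨅ k, ∫⁻ ω, ∏ n ∈ Finset.range k, u n ω ∂P :=
  lintegral_iInf (fun _ => Finset.measurable_prod _ fun n _ => hm n)
    (fun _ _ hkl ω => prod_range_antitone (fun n => hu n ω) hkl) (by simp)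

/-! ### The Laplace functional of a Poisson point process -/

lemma lintegral_pow_poissonMeasure (r : ℝ≥0) {c : ℝ} (hc : 0 ≤ c) :
    ∫⁻ n, ENNReal.ofReal c ^ n ∂(poissonMeasure r) = ENNReal.ofReal (Real.exp (-(r * (1 - c)))) := by
  rw [lintegral_countable']
  simp_rw [poissonMeasure_singleton, ← ENNReal.ofReal_pow hc]
  simp_rw [← ENNReal.ofReal_mul (pow_nonneg hc _)]
  have h := (NormedSpace.expSeries_div_hasSum_exp (𝔸 := ℝ) ((r : ℝ) * c)).mul_left (Real.exp (-r))
  rw [← Real.exp_eq_exp_ℝ, ← Real.exp_add] at h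
  have h' : HasSum (fun n : ℕ => c ^ n * (Real.exp (-r) * r ^ n / (n.factorial : ℝ)))
      (Real.exp (-(r * (1 - c)))) := by
    rw [show -(r * (1 - c)) = -r + r * c by ring]
    refine h.congr_fun fun n => ?_
    rw [mul_pow]
    ring
  rw [← h'.tsum_eq, ENNReal.ofReal_tsum_of_nonneg (fun n => by positivity) h'.summable]

variable {Ω : Type*} [MeasurableSpace Ω] {P : Measure Ω} {lam : ℝ≥0} {X : ℕ → Ω → Plane}

namespace IsHomogeneousPPP

lemma ae_finite (hX : IsHomogeneousPPP P lam X) {S : Set Plane} (hS : MeasurableSet S)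
    (hv : volume S ≠ ∞) : ∀ᵐ ω ∂P, {n | X n ω ∈ S}.Finite := by
  have h := hX.hasLaw_count S hS hv
  have : ∀ᵐ x ∂((poissonMeasure (lam * (volume S).toNNReal)).map (Nat.cast : ℕ → ℕ∞)), x ≠ ⊤ := by
    rw [ae_map_iff (by fun_prop) (MeasurableSet.of_discrete)]
    simp
  rw [← h.map_eq] at this
  filter_upwards [ae_of_ae_map h.aemeasurable this] with ω hω
  exact Set.encard_ne_top_iff.1 hω

lemma lintegral_pow_count (hX : IsHomogeneousPPP P lam X) {S : Set Plane} (hS : MeasurableSet S)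
    (hv : volume S ≠ ∞) {c : ℝ} (hc : 0 ≤ c) :
    ∫⁻ ω, ENNReal.ofReal c ^ ({n | X n ω ∈ S}.encard).toNat ∂P =
      ENNReal.ofReal (Real.exp (-(lam * (volume S).toReal * (1 - c)))) := by
  have h := hX.hasLaw_count S hS hv
  rw [← lintegral_map' (f := fun k : ℕ∞ => ENNReal.ofReal c ^ k.toNat)
    (Measurable.of_discrete.aemeasurable) h.aemeasurable, h.map_eq,
    lintegral_map Measurable.of_discrete (by fun_prop)]
  exact lintegral_pow_poissonMeasure (lam * (volume S).toNNReal) hc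

/-- Finiteness matters: `toNat` sends an infinite count to 0, which would turn the power into 1. -/
lemma expProd_ite_eq_pow {x : ℕ → Plane} {S : Set Plane} (hf : {n | x n ∈ S}.Finite) {c : ℝ≥0∞}
    (hc : c ≤ 1) [DecidablePred (· ∈ S)] :
    expProd (fun n => if x n ∈ S then c else 1) = c ^ ({n | x n ∈ S}.encard).toNat := by
  rw [expProd_eq_finset_prod (fun n => by split_ifs <;> simp [hc]) hf.toFinset
    (fun n hn => by simp_all), Finset.prod_congr rfl (g := fun _ => c) (fun n hn => by simp_all),
    Finset.prod_const, ← Set.ncard_eq_toFinset_card _ hf]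
  rfl

lemma lintegral_expProd_ite (hX : IsHomogeneousPPP P lam X) {S : Set Plane}
    (hS : MeasurableSet S) (hv : volume S ≠ ∞) {c : ℝ≥0∞} (hc : c ≤ 1)
    [DecidablePred (· ∈ S)] :
    ∫⁻ ω, expProd (fun n => if X n ω ∈ S then 1 - c else 1) ∂P =
      ENNReal.ofReal (Real.exp (-(lam * (volume S * c).toReal))) := by
  have hc' : c ≠ ∞ := (hc.trans_lt ENNReal.one_lt_top).ne
  have h1 : (1 - c).toReal = 1 - c.toReal := by
    rw [ENNReal.toReal_sub_of_le hc (by simp)]; simp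
  have h2 : ENNReal.ofReal (1 - c).toReal = 1 - c :=
    ENNReal.ofReal_toReal (ne_top_of_le_ne_top ENNReal.one_ne_top tsub_le_self)
  rw [lintegral_congr_ae (g := fun ω => (1 - c) ^ ({n | X n ω ∈ S}.encard).toNat)]
  · rw [← h2, hX.lintegral_pow_count hS hv ENNReal.toReal_nonneg, h1, ENNReal.toReal_mul]
    congr 2; ring
  · filter_upwards [hX.ae_finite hS hv] with ω hω
    exact expProd_ite_eq_pow hω tsub_le_self

/-- The Laplace functional of a Poisson point process, for simple functions. -/
lemma lintegral_expProd_simpleFunc (hX : IsHomogeneousPPP P lam X) (φ : SimpleFunc Plane ℝ≥0∞)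
    (hφ : ∀ x, φ x ≤ 1) (hfin : φ.lintegral volume ≠ ∞) :
    ∫⁻ ω, expProd (fun n => 1 - φ (X n ω)) ∂P =
      ENNReal.ofReal (Real.exp (-(lam * (φ.lintegral volume).toReal))) := by
  classical
  -- The value 0 is dropped because its level set may have infinite area; the other level sets have
  -- finite area as `φ` is integrable.
  set s := φ.range.filter (· ≠ 0) with hs
  let e := s.equivFin
  let c : Fin s.card → ℝ≥0∞ := fun i => (e.symm i).1
  let S : Fin s.card → Set Plane := fun i => φ ⁻¹' {c i}
  have hcne (i) : c i ≠ 0 := (Finset.mem_filter.1 (e.symm i).2).2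
  have hcle (i) : c i ≤ 1 := by
    obtain ⟨x, hx⟩ := SimpleFunc.mem_range.1 (Finset.mem_filter.1 (e.symm i).2).1
    exact hx.symm.trans_le (hφ x)
  have hinj : Function.Injective c := fun i j hij => e.symm.injective (Subtype.ext hij)
  have hsum : φ.lintegral volume = ∑ i, volume (S i) * c i := by
    rw [SimpleFunc.lintegral_eq_of_subset' φ (s := s)]
    · rw [← Finset.sum_coe_sort s, ← e.symm.sum_comp]
      exact Finset.sum_congr rfl fun i _ => mul_comm _ _
    · intro x hx
      simpa [hs] using hx
  have hmul (i) : volume (S i) * c i ≠ ∞ := by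
    rw [hsum] at hfin
    exact (ENNReal.sum_ne_top.1 hfin) i (Finset.mem_univ i)
  have hv (i) : volume (S i) ≠ ∞ := fun h => hmul i (by rw [h, ENNReal.top_mul (hcne i)])
  have hSm (i) : MeasurableSet (S i) := φ.measurableSet_preimage _
  have hdisj : Pairwise fun i j => Disjoint (S i) (S j) := fun i j hij =>
    Disjoint.preimage _ (by simpa using hinj.ne hij)
  have hle (i) (n : ℕ) (ω : Ω) : (if X n ω ∈ S i then 1 - c i else 1) ≤ 1 := by
    split_ifs
    · exact tsub_le_self
    · rfl
  -- The level sets are disjoint, so at most one factor differs from 1. The product then splits into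
  -- powers of independent Poisson counts.
  have hprod (x : Plane) : 1 - φ x = ∏ i, if x ∈ S i then 1 - c i else 1 := by
    by_cases h0 : φ x = 0
    · rw [Finset.prod_eq_one, h0, tsub_zero]
      intro i _
      rw [if_neg]
      intro hx
      exact hcne i (by rw [← h0]; exact hx.symm)
    · have hmem : φ x ∈ s := by simp [hs, h0]
      rw [Finset.prod_eq_single (e ⟨φ x, hmem⟩)]
      · simp [S, c]
      · intro i _ hi
        rw [if_neg]
        intro hx
        refine hi (e.symm.injective (Subtype.ext ?_))
        simpa using (show φ x = c i from hx).symm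
      · simp
  simp_rw [hprod]
  rw [lintegral_congr fun ω => expProd_prod Finset.univ
    (u := fun i n => if X n ω ∈ S i then 1 - c i else 1) fun i n => hle i n ω]
  have hind : iIndepFun (fun i ω => expProd fun n => if X n ω ∈ S i then 1 - c i else 1) P := by
    refine ((hX.indep_count _ S hSm hv hdisj).comp (fun i k => (1 - c i) ^ k.toNat)
      fun i => Measurable.of_discrete).congr fun i => ?_
    filter_upwards [hX.ae_finite (hSm i) (hv i)] with ω hω
    exact (expProd_ite_eq_pow hω tsub_le_self).symm
  rw [lintegral_prod_eq_prod_lintegral_of_indepFun _ _ hind fun i => measurable_expProd fun n =>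
    Measurable.ite (hX.measurable n (hSm i)) measurable_const measurable_const]
  simp_rw [hX.lintegral_expProd_ite (hSm _) (hv _) (hcle _)]
  rw [← ENNReal.ofReal_prod_of_nonneg fun i _ => (Real.exp_pos _).le, ← Real.exp_sum, hsum,
    ENNReal.toReal_sum fun i _ => hmul i, Finset.mul_sum, Finset.sum_neg_distrib]

/-- The Laplace functional of a Poisson point process. -/
theorem lintegral_expProd_one_sub (hX : IsHomogeneousPPP P lam X) {g : Plane → ℝ≥0∞}
    (hg : Measurable g) (hg1 : ∀ x, g x ≤ 1) (hfin : ∫⁻ x, g x ≠ ∞) :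
    ∫⁻ ω, expProd (fun n => 1 - g (X n ω)) ∂P =
      ENNReal.ofReal (Real.exp (-(lam * (∫⁻ x, g x).toReal))) := by
  let φ := SimpleFunc.eapprox g
  have hφg (k) (x) : φ k x ≤ g x := by
    rw [← SimpleFunc.iSup_eapprox_apply hg x]
    exact le_iSup (fun k => φ k x) k
  have hint (k) : (φ k).lintegral volume ≤ ∫⁻ x, g x := by
    rw [← SimpleFunc.lintegral_eq_lintegral]
    exact lintegral_mono fun x => hφg k x
  have hk (k) := hX.lintegral_expProd_simpleFunc (φ k) (fun x => (hφg k x).trans (hg1 x))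
    (ne_top_of_le_ne_top hfin (hint k))
  have hanti (n : ℕ) (ω : Ω) : Antitone fun k => 1 - φ k (X n ω) := fun k l hkl =>
    tsub_le_tsub_left (SimpleFunc.monotone_eapprox g hkl _) 1
  have hprod (ω : Ω) : expProd (fun n => 1 - g (X n ω)) =
      ⨅ k, expProd fun n => 1 - φ k (X n ω) := by
    rw [expProd_iInf (fun _ _ => tsub_le_self) fun n => hanti n ω]
    refine congr_arg _ (funext fun n => ?_)
    rw [← SimpleFunc.iSup_eapprox_apply hg, ENNReal.sub_iSup ENNReal.one_ne_top]
  have hmeas (k) : Measurable fun ω => expProd fun n => 1 - φ k (X n ω) :=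
    measurable_expProd fun n => measurable_const.sub ((φ k).measurable.comp (hX.measurable n))
  simp_rw [hprod]
  have hmono : Antitone fun k => fun ω => expProd fun n => 1 - φ k (X n ω) := fun k l hkl ω =>
    iInf_mono fun K => Finset.prod_le_prod' fun n _ => hanti n ω hkl
  rw [lintegral_iInf hmeas hmono (by rw [hk]; exact ENNReal.ofReal_ne_top)]
  refine tendsto_nhds_unique (tendsto_atTop_iInf fun k l hkl => lintegral_mono (hmono hkl)) ?_
  simp_rw [hk]
  refine (ENNReal.continuous_ofReal.tendsto _).comp ((Real.continuous_exp.tendsto _).comp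
    (Tendsto.neg (Tendsto.const_mul _ ((ENNReal.tendsto_toReal hfin).comp ?_))))
  rw [lintegral_eq_iSup_eapprox_lintegral hg]
  exact tendsto_atTop_iSup fun k l hkl =>
    SimpleFunc.lintegral_mono (SimpleFunc.monotone_eapprox g hkl) le_rfl

end IsHomogeneousPPP


/-! ### Marked points -/

instance : DiscreteMeasurableSpace FilePortion := ⟨fun _ => trivial⟩

/-- The marks of a device: file portion, activity, fading. -/
abbrev Mark : Type := FilePortion × ℝ × ℝ

/-- The law of the mark of a device. -/
noncomputable abbrev markLaw (p q : I) : Measure Mark :=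
  (bernoulliMeasure FilePortion.A FilePortion.B p).prod
    ((bernoulliMeasure (1 : ℝ) 0 q).prod (expMeasure 1))

instance : IsProbabilityMeasure (expMeasure 1) := isProbabilityMeasure_expMeasure one_pos

variable {Ω : Type*} [MeasurableSpace Ω] {P : Measure Ω} {lam : ℝ≥0}
  {p q : I} {N : Network Ω}

namespace Network

/-- The location of a device together with its mark. -/
def point (N : Network Ω) (n : ℕ) (ω : Ω) : Plane × Mark := (N.location n ω, N.mark n ω)

/-- The event that no marked point lies in `T`. -/
def avoid (N : Network Ω) (T : Set (Plane × Mark)) : Set Ω := {ω | ∀ n, N.point n ω ∉ T}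

namespace IsModel

lemma measurable_point (hN : N.IsModel P lam p q) (n : ℕ) : Measurable (N.point n) :=
  (hN.ppp.measurable n).prodMk (hN.measurable_mark n)

lemma measurableSet_avoid (hN : N.IsModel P lam p q) {T : Set (Plane × Mark)}
    (hT : MeasurableSet T) : MeasurableSet (N.avoid T) := by
  rw [show N.avoid T = ⋂ n, N.point n ⁻¹' Tᶜ by ext; simp [avoid]]
  exact MeasurableSet.iInter fun n => hN.measurable_point n hT.compl

/-- By independence of locations and marks, the locations can be frozen while the i.i.d. marks are
integrated out one factor at a time. -/
lemma lintegral_prod_point (hN : N.IsModel P lam p q) {u : Plane × Mark → ℝ≥0∞}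
    (hu : Measurable u) (s : Finset ℕ) :
    ∫⁻ ω, ∏ n ∈ s, u (N.point n ω) ∂P =
      ∫⁻ ω, ∏ n ∈ s, ∫⁻ m, u (N.location n ω, m) ∂(markLaw p q) ∂P := by
  have := hN.iIndepFun_mark.isProbabilityMeasure
  have hX : Measurable fun ω n => N.location n ω := measurable_pi_lambda _ hN.ppp.measurable
  have hM : Measurable fun ω n => N.mark n ω := measurable_pi_lambda _ hN.measurable_mark
  have hF : Measurable fun z : (ℕ → Plane) × (ℕ → Mark) => ∏ n ∈ s, u (z.1 n, z.2 n) :=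
    Finset.measurable_prod _ fun n _ => hu.comp
      (((measurable_pi_apply n).comp measurable_fst).prodMk
        ((measurable_pi_apply n).comp measurable_snd))
  calc ∫⁻ ω, ∏ n ∈ s, u (N.point n ω) ∂P
      = ∫⁻ z, ∏ n ∈ s, u (z.1 n, z.2 n)
          ∂(P.map fun ω => ((fun n => N.location n ω), fun n => N.mark n ω)) :=
        (lintegral_map hF (hX.prodMk hM)).symm
    _ = ∫⁻ x, ∫⁻ m, ∏ n ∈ s, u (x n, m n) ∂(P.map fun ω n => N.mark n ω)
          ∂(P.map fun ω n => N.location n ω) := by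
        rw [(indepFun_iff_map_prod_eq_prod_map_map hX.aemeasurable hM.aemeasurable).1
          hN.indepFun_location_mark, lintegral_prod _ hF.aemeasurable]
    _ = ∫⁻ x, ∏ n ∈ s, ∫⁻ m, u (x n, m) ∂(markLaw p q) ∂(P.map fun ω n => N.location n ω) := by
        refine lintegral_congr fun x => ?_
        rw [lintegral_map (f := fun m : ℕ → Mark => ∏ n ∈ s, u (x n, m n))
          (hF.comp measurable_prodMk_left) hM]
        have hux (n) : Measurable fun m => u (x n, m) := hu.comp measurable_prodMk_left
        rw [lintegral_prod_eq_prod_lintegral_of_indepFun s (fun n ω => u (x n, N.mark n ω))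
          (hN.iIndepFun_mark.comp _ hux) fun n => (hux n).comp (hN.measurable_mark n)]
        refine Finset.prod_congr rfl fun n _ => ?_
        rw [show markLaw p q = P.map (N.mark n) from (hN.hasLaw_mark n).map_eq.symm,
          lintegral_map (hux n) (hN.measurable_mark n)]
    _ = _ := lintegral_map (Finset.measurable_prod _ fun n _ =>
        hu.lintegral_prod_right'.comp (measurable_pi_apply n)) hX

lemma lintegral_expProd_point (hN : N.IsModel P lam p q) {u : Plane × Mark → ℝ≥0∞}
    (hu : Measurable u) (hu1 : ∀ z, u z ≤ 1) :
    ∫⁻ ω, expProd (fun n => u (N.point n ω)) ∂P =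
      ∫⁻ ω, expProd (fun n => ∫⁻ m, u (N.location n ω, m) ∂(markLaw p q)) ∂P := by
  have := hN.iIndepFun_mark.isProbabilityMeasure
  rw [D2DCaching.lintegral_expProd (u := fun n ω => u (N.point n ω))
      (fun n => hu.comp (hN.measurable_point n)) fun n ω => hu1 _,
    D2DCaching.lintegral_expProd
      (u := fun n ω => ∫⁻ m, u (N.location n ω, m) ∂(markLaw p q))
      (fun n => hu.lintegral_prod_right'.comp (hN.ppp.measurable n))
      fun n ω => (lintegral_mono fun m => hu1 _).trans (by simp)]
  exact iInf_congr fun k => hN.lintegral_prod_point hu _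

/-- The Laplace functional of the marked Poisson point process. -/
theorem lintegral_expProd (hN : N.IsModel P lam p q) {u : Plane × Mark → ℝ≥0∞}
    (hu : Measurable u) (hu1 : ∀ z, u z ≤ 1)
    (hfin : ∫⁻ x, ∫⁻ m, (1 - u (x, m)) ∂(markLaw p q) ≠ ∞) :
    ∫⁻ ω, expProd (fun n => u (N.point n ω)) ∂P =
      ENNReal.ofReal (Real.exp
        (-(lam * (∫⁻ x, ∫⁻ m, (1 - u (x, m)) ∂(markLaw p q)).toReal))) := by
  have hle (x) : ∫⁻ m, u (x, m) ∂(markLaw p q) ≤ 1 :=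
    (lintegral_mono fun m => hu1 _).trans (by simp)
  have hsub (x) : ∫⁻ m, (1 - u (x, m)) ∂(markLaw p q) = 1 - ∫⁻ m, u (x, m) ∂(markLaw p q) := by
    rw [lintegral_sub (g := fun m => u (x, m)) (hu.comp measurable_prodMk_left)
      (ne_top_of_le_ne_top ENNReal.one_ne_top (hle x)) (ae_of_all _ fun m => hu1 _)]
    simp
  -- Averaging over the marks leaves an unmarked functional, with `g x` the mean of `1 - u (x, m)`.
  rw [hN.lintegral_expProd_point hu hu1, ← hN.ppp.lintegral_expProd_one_sub
    (g := fun x => ∫⁻ m, (1 - u (x, m)) ∂(markLaw p q))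
    (measurable_const.sub hu).lintegral_prod_right'
    (fun x => (hsub x).trans_le tsub_le_self) hfin]
  refine lintegral_congr fun ω => congr_arg _ (funext fun n => ?_)
  simp only [hsub]
  rw [ENNReal.sub_sub_cancel ENNReal.one_ne_top (hle _)]

/-- Functionals of the marked points inside and outside a set are independent. -/
theorem lintegral_expProd_mul (hN : N.IsModel P lam p q) {u w : Plane × Mark → ℝ≥0∞}
    (hu : Measurable u) (hu1 : ∀ z, u z ≤ 1)
    (hufin : ∫⁻ x, ∫⁻ m, (1 - u (x, m)) ∂(markLaw p q) ≠ ∞)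
    (hw : Measurable w) (hw1 : ∀ z, w z ≤ 1)
    (hwfin : ∫⁻ x, ∫⁻ m, (1 - w (x, m)) ∂(markLaw p q) ≠ ∞)
    (huw : ∀ z, u z = 1 ∨ w z = 1) :
    ∫⁻ ω, expProd (fun n => u (N.point n ω)) * expProd (fun n => w (N.point n ω)) ∂P =
      (∫⁻ ω, expProd (fun n => u (N.point n ω)) ∂P) *
        ∫⁻ ω, expProd (fun n => w (N.point n ω)) ∂P := by
  -- At each point one of `u`, `w` equals 1, so 1 - uw = (1 - u) + (1 - w): the exponents add and
  -- the exponentials multiply.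
  have hadd : ∫⁻ x, ∫⁻ m, (1 - u (x, m) * w (x, m)) ∂(markLaw p q) =
      (∫⁻ x, ∫⁻ m, (1 - u (x, m)) ∂(markLaw p q)) +
        ∫⁻ x, ∫⁻ m, (1 - w (x, m)) ∂(markLaw p q) := by
    have hmeas : Measurable fun z => 1 - u z := measurable_const.sub hu
    rw [← lintegral_add_left (f := fun x => ∫⁻ m, (1 - u (x, m)) ∂(markLaw p q))
      hmeas.lintegral_prod_right']
    refine lintegral_congr fun x => ?_
    rw [← lintegral_add_left (f := fun m => 1 - u (x, m)) (hmeas.comp measurable_prodMk_left)]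
    refine lintegral_congr fun m => ?_
    rcases huw (x, m) with h | h <;> simp [h]
  simp_rw [← expProd_mul (fun n => hu1 _) (fun n => hw1 _)]
  rw [hN.lintegral_expProd (u := fun z => u z * w z) (hu.mul hw)
      (fun z => mul_le_one' (hu1 z) (hw1 z))
      (by rw [hadd]; exact ENNReal.add_ne_top.2 ⟨hufin, hwfin⟩),
    hN.lintegral_expProd hu hu1 hufin, hN.lintegral_expProd hw hw1 hwfin, hadd,
    ENNReal.toReal_add hufin hwfin, ← ENNReal.ofReal_mul (Real.exp_pos _).le, ← Real.exp_add]
  congr 2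
  ring

end IsModel

-- This makes the indicator of a void event a multiplicative functional, to which the Laplace
-- functional applies.
omit [MeasurableSpace Ω] in
lemma expProd_indicator_compl (N : Network Ω) (T : Set (Plane × Mark)) (ω : Ω) :
    expProd (fun n => Tᶜ.indicator 1 (N.point n ω)) = (N.avoid T).indicator 1 ω := by
  by_cases h : ω ∈ N.avoid T
  · rw [indicator_of_mem h, Pi.one_apply, ← expProd_one]
    exact congr_arg _ (funext fun n => indicator_of_mem (h n) _)
  · rw [indicator_of_notMem h]
    obtain ⟨n, hn⟩ : ∃ n, N.point n ω ∈ T := by simpa [avoid] using h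
    exact expProd_eq_zero (n := n) (indicator_of_notMem (by simpa using hn) _)

end Network

/-! ### Void probabilities and independence from void events -/

lemma lintegral_one_sub_indicator_compl (T : Set (Plane × Mark)) (p q : I)
    (hT : MeasurableSet T) :
    ∫⁻ x, ∫⁻ m, (1 - Tᶜ.indicator 1 (x, m)) ∂(markLaw p q) =
      ((volume : Measure Plane).prod (markLaw p q)) T := by
  rw [Measure.prod_apply hT]
  refine lintegral_congr fun x => ?_
  rw [← lintegral_indicator_one (hT.preimage measurable_prodMk_left)]
  refine lintegral_congr fun m => ?_
  by_cases h : (x, m) ∈ T <;> simp [h]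

namespace Network.IsModel

lemma measure_avoid (hN : N.IsModel P lam p q) {T : Set (Plane × Mark)} (hT : MeasurableSet T)
    (hfin : ((volume : Measure Plane).prod (markLaw p q)) T ≠ ∞) :
    P (N.avoid T) = ENNReal.ofReal (Real.exp
      (-(lam * (((volume : Measure Plane).prod (markLaw p q)) T).toReal))) := by
  rw [← lintegral_one_sub_indicator_compl T p q hT] at hfin ⊢
  rw [← hN.lintegral_expProd (measurable_one.indicator hT.compl)
    (fun z => indicator_le (fun _ _ => le_rfl) z) hfin]
  simp_rw [expProd_indicator_compl]
  rw [lintegral_indicator_one (hN.measurableSet_avoid hT)]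

lemma setLIntegral_avoid (hN : N.IsModel P lam p q) {T : Set (Plane × Mark)}
    (hT : MeasurableSet T) (hfin : ((volume : Measure Plane).prod (markLaw p q)) T ≠ ∞)
    {w : Plane × Mark → ℝ≥0∞} (hw : Measurable w) (hw1 : ∀ z, w z ≤ 1)
    (hwfin : ∫⁻ x, ∫⁻ m, (1 - w (x, m)) ∂(markLaw p q) ≠ ∞) (hwT : ∀ z ∈ T, w z = 1) :
    ∫⁻ ω in N.avoid T, expProd (fun n => w (N.point n ω)) ∂P =
      P (N.avoid T) * ∫⁻ ω, expProd (fun n => w (N.point n ω)) ∂P := by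
  have h := hN.lintegral_expProd_mul (u := Tᶜ.indicator 1) (w := w)
    (measurable_one.indicator hT.compl)
    (fun z => indicator_le (fun _ _ => le_rfl) z)
    (by rwa [lintegral_one_sub_indicator_compl T p q hT]) hw hw1 hwfin (fun z => by
      by_cases hz : z ∈ T
      · exact .inr (hwT z hz)
      · exact .inl (by simp [hz]))
  simp_rw [expProd_indicator_compl] at h
  rw [lintegral_indicator_one (hN.measurableSet_avoid hT)] at h
  rw [← h, ← lintegral_indicator (hN.measurableSet_avoid hT)]
  refine lintegral_congr fun ω => ?_
  by_cases hω : ω ∈ N.avoid T <;> simp [hω]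

/-- A file portion of positive probability is almost surely cached by some device. -/
lemma ae_exists_file (hN : N.IsModel P lam p q) (hlam : 0 < lam) {F : FilePortion}
    (hF : bernoulliMeasure FilePortion.A FilePortion.B p {F} ≠ 0) :
    ∀ᵐ ω ∂P, ∃ n, N.file n ω = F := by
  have hB : 0 < (bernoulliMeasure FilePortion.A FilePortion.B p {F}).toReal :=
    ENNReal.toReal_pos hF (measure_ne_top _ _)
  set b := (bernoulliMeasure FilePortion.A FilePortion.B p {F}).toReal with hb
  let T (r : ℕ) : Set (Plane × Mark) := Metric.closedBall 0 (r : ℝ) ×ˢ ({F} ×ˢ univ)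
  have hTm (r) : MeasurableSet (T r) :=
    Metric.isClosed_closedBall.measurableSet.prod ((MeasurableSet.of_discrete).prod .univ)
  have hvol (r) : ((volume : Measure Plane).prod (markLaw p q)) (T r) =
      ENNReal.ofReal (r ^ 2 * Real.pi * b) := by
    rw [Measure.prod_prod, Measure.prod_prod, measure_univ, mul_one,
      EuclideanSpace.volume_closedBall_fin_two, ← ENNReal.ofReal_toReal (measure_ne_top _ {F}),
      ← hb, ENNReal.ofReal_mul (by positivity), ENNReal.ofReal_mul (by positivity),
      ENNReal.ofReal_pow (by positivity)]
  -- If no device caches `F`, then every disc is void of such devices; the probability of that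
  -- decays like exp(-λ b π r²).
  have hP (r : ℕ) : P {ω | ¬ ∃ n, N.file n ω = F} ≤
      ENNReal.ofReal (Real.exp (-(lam * (r ^ 2 * Real.pi * b)))) := by
    rw [← ENNReal.toReal_ofReal (show 0 ≤ r ^ 2 * Real.pi * b by positivity), ← hvol r,
      ← hN.measure_avoid (hTm r) (by rw [hvol]; exact ENNReal.ofReal_ne_top)]
    refine measure_mono fun ω hω n hn => hω ⟨n, ?_⟩
    exact hn.2.1
  rw [ae_iff]
  have h0 : P {ω | ¬ ∃ n, N.file n ω = F} ≤ 0 := by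
    refine ge_of_tendsto' (x := atTop) ?_ hP
    rw [← ENNReal.ofReal_zero]
    refine (ENNReal.continuous_ofReal.tendsto _).comp (Real.tendsto_exp_neg_atTop_nhds_zero.comp ?_)
    have h1 : Tendsto (fun r : ℕ => (lam * (Real.pi * b)) * (r : ℝ) ^ 2) atTop atTop := by
      refine Tendsto.const_mul_atTop (by positivity) ?_
      exact (tendsto_pow_atTop two_ne_zero).comp tendsto_natCast_atTop_atTop
    refine h1.congr fun r => ?_
    ring
  exact le_antisymm h0 zero_le

end Network.IsModel


/-! ### The interference of the marked points -/

/-- The power received at the origin from a marked point that caches `A`. -/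
noncomputable def gain (α : ℝ) : Plane × Mark → ℝ :=
  {z | z.2.1 = FilePortion.A}.indicator fun z => |z.2.2.1 * z.2.2.2| * ‖z.1‖ ^ (-α)

/-- The absolute value in `gain` makes this hold for every mark and not only almost surely;
`Regular.nonneg` removes it again in `Regular.I3term_eq`. -/
lemma gain_nonneg (α : ℝ) (z : Plane × Mark) : 0 ≤ gain α z :=
  indicator_nonneg (fun _ _ => by positivity) z

lemma measurableSet_file (F : FilePortion) : MeasurableSet {z : Plane × Mark | z.2.1 = F} :=
  (MeasurableSet.of_discrete (s := {F})).preimage (by fun_prop)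

lemma measurable_gain (α : ℝ) : Measurable (gain α) :=
  Measurable.indicator (by fun_prop) (measurableSet_file _)

/-- The interference from outside of `K` of a single marked point. -/
noncomputable def gainOutside (α : ℝ) (K : Set Plane) : Plane × Mark → ℝ :=
  (Kᶜ ×ˢ univ).indicator (gain α)

lemma gainOutside_nonneg (α : ℝ) (K : Set Plane) (z : Plane × Mark) : 0 ≤ gainOutside α K z :=
  indicator_nonneg (fun _ _ => gain_nonneg α _) z

lemma gainOutside_le (α : ℝ) (K : Set Plane) (z : Plane × Mark) :
    gainOutside α K z ≤ gain α z :=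
  indicator_le_self' (fun _ _ => gain_nonneg α _) z

lemma measurable_gainOutside (α : ℝ) {K : Set Plane} (hK : MeasurableSet K) :
    Measurable (gainOutside α K) :=
  (measurable_gain α).indicator (hK.compl.prod .univ)

/-- The factor by which a marked point contributes to `exp (-s * interference)`. -/
noncomputable def weight (α s : ℝ) (K : Set Plane) (z : Plane × Mark) : ℝ≥0∞ :=
  ENNReal.ofReal (Real.exp (-(s * gainOutside α K z)))

lemma measurable_weight (α s : ℝ) {K : Set Plane} (hK : MeasurableSet K) :
    Measurable (weight α s K) :=
  ((measurable_gainOutside α hK).const_mul s).neg.exp.ennreal_ofReal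

lemma weight_le_one {α s : ℝ} (hs : 0 ≤ s) (K : Set Plane) (z : Plane × Mark) :
    weight α s K z ≤ 1 := by
  simpa [weight] using mul_nonneg hs (gainOutside_nonneg α K z)

/-- One minus the Laplace transform at `s` of the power `h * ‖x‖ ^ (-α)` that the origin receives
from an active device at `x`, where `h` is the exponential fading gain. -/
noncomputable def pathLoss (α s : ℝ) (x : Plane) : ℝ := 1 / (1 + ‖x‖ ^ α / s)

lemma pathLoss_nonneg {α s : ℝ} (hs : 0 < s) (x : Plane) : 0 ≤ pathLoss α s x := by
  unfold pathLoss; positivity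

lemma pathLoss_mono {α s t : ℝ} (hs : 0 < s) (hst : s ≤ t) (x : Plane) :
    pathLoss α s x ≤ pathLoss α t x := by
  unfold pathLoss
  have : 0 < t := hs.trans_le hst
  gcongr

@[fun_prop]
lemma measurable_pathLoss (α s : ℝ) : Measurable (pathLoss α s) := by
  unfold pathLoss; fun_prop

/-- Comparison with (1 + ‖x‖)^(-α), which is integrable because `α` exceeds the dimension 2 of the
plane. -/
lemma integrable_pathLoss {α s : ℝ} (hα : 2 < α) (hs : 0 < s) : Integrable (pathLoss α s) := by
  have h := integrable_one_add_norm (E := Plane) (μ := volume) (r := α) (by simpa using hα)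
  -- The constant combines 1 + ‖x‖ ≤ 2 max(1, ‖x‖) with max(1, ‖x‖^α) ≤ max(1, s) (1 + ‖x‖^α/s).
  refine (h.const_mul (2 ^ α * max 1 s)).mono' (by fun_prop) (ae_of_all _ fun x => ?_)
  rw [Real.norm_of_nonneg (pathLoss_nonneg hs x), Real.rpow_neg (by positivity), pathLoss,
    ← div_eq_mul_inv, div_le_div_iff₀ (by positivity) (by positivity), one_mul]
  have h1 : (1 + ‖x‖) ^ α ≤ 2 ^ α * max 1 (‖x‖ ^ α) := by
    have : (1 + ‖x‖) ≤ 2 * max 1 ‖x‖ := by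
      linarith [le_max_left 1 ‖x‖, le_max_right 1 ‖x‖]
    refine (Real.rpow_le_rpow (by positivity) this (by linarith)).trans ?_
    rw [Real.mul_rpow (by positivity) (by positivity)]
    gcongr
    rcases le_total 1 ‖x‖ with h | h
    · simp [h]
    · simp [h]
  have h2 : max 1 (‖x‖ ^ α) ≤ max 1 s * (1 + ‖x‖ ^ α / s) := by
    have h3 : 0 ≤ ‖x‖ ^ α / s := by positivity
    refine max_le ?_ ?_
    · nlinarith [le_max_left 1 s]
    · calc ‖x‖ ^ α = s * (‖x‖ ^ α / s) := by field_simp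
        _ ≤ max 1 s * (1 + ‖x‖ ^ α / s) := by
          gcongr
          · exact le_max_right 1 s
          · linarith
  calc (1 + ‖x‖) ^ α ≤ 2 ^ α * max 1 (‖x‖ ^ α) := h1
    _ ≤ 2 ^ α * (max 1 s * (1 + ‖x‖ ^ α / s)) := by gcongr
    _ = _ := by ring

lemma lintegral_one_sub_exp_expMeasure {c : ℝ} (hc : 0 ≤ c) :
    ∫⁻ h, (1 - ENNReal.ofReal (Real.exp (-(c * |h|)))) ∂(expMeasure 1) =
      ENNReal.ofReal (c / (1 + c)) := by
  have hm : Measurable fun h : ℝ => ENNReal.ofReal (Real.exp (-(c * |h|))) := by fun_prop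
  have hle (h : ℝ) : ENNReal.ofReal (Real.exp (-(c * |h|))) ≤ 1 := by
    simpa using mul_nonneg hc (abs_nonneg h)
  have key : ∫⁻ h, ENNReal.ofReal (Real.exp (-(c * |h|))) ∂(expMeasure 1) =
      ENNReal.ofReal (1 / (1 + c)) := by
    have hd : expMeasure 1 = volume.withDensity (exponentialPDF 1) := rfl
    have hpdf : Measurable (exponentialPDF 1) :=
      (measurable_exponentialPDFReal 1).ennreal_ofReal
    rw [hd, lintegral_withDensity_eq_lintegral_mul _ hpdf hm]
    have hI : IntegrableOn (fun h : ℝ => Real.exp (-(1 + c) * h)) (Ioi 0) :=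
      integrableOn_exp_mul_Ioi (by linarith) 0
    have hv : ∫ h in Ioi (0 : ℝ), Real.exp (-(1 + c) * h) = 1 / (1 + c) := by
      rw [integral_exp_mul_Ioi (by linarith)]
      rw [mul_zero, Real.exp_zero, neg_div, ← div_neg, neg_neg]
    rw [← hv, ofReal_integral_eq_lintegral_ofReal hI (ae_of_all _ fun h => (Real.exp_pos _).le),
      ← lintegral_indicator measurableSet_Ioi]
    refine lintegral_congr_ae ?_
    filter_upwards [Measure.ae_ne volume (0 : ℝ)] with h h0
    rcases lt_or_gt_of_ne h0 with hh | hh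
    · simp [exponentialPDF_of_neg hh, hh.le]
    · rw [Pi.mul_apply, exponentialPDF_of_nonneg hh.le, indicator_of_mem (by exact hh),
        ← ENNReal.ofReal_mul (by positivity), abs_of_pos hh, one_mul, ← Real.exp_add]
      congr 2
      ring
  rw [lintegral_sub hm (by rw [key]; exact ENNReal.ofReal_ne_top) (ae_of_all _ hle), key,
    lintegral_one, measure_univ, ← ENNReal.ofReal_one, ← ENNReal.ofReal_sub _ (by positivity)]
  congr 1
  field_simp
  ring

/-- Only active devices caching `A` contribute, whence the factor p q; for them the exponential
Laplace transform gives `pathLoss`. The origin, a null set, is excluded because `0 ^ (-α)` is `0`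
for nonzero `α`, whereas `pathLoss` is then `1` there. -/
lemma lintegral_one_sub_weight {α s : ℝ} (hs : 0 < s) (p q : I) {K : Set Plane}
    (hK : MeasurableSet K) {x : Plane} (hx0 : x ≠ 0) :
    ∫⁻ m, (1 - weight α s K (x, m)) ∂(markLaw p q) =
      Kᶜ.indicator (fun x => ENNReal.ofReal (p * q * pathLoss α s x)) x := by
  by_cases hx : x ∈ K
  · simp [weight, gainOutside, hx]
  have hm : Measurable fun m => 1 - weight α s K (x, m) :=
    measurable_const.sub ((measurable_weight α s hK).comp measurable_prodMk_left)
  rw [indicator_of_mem (by exact hx), lintegral_prod _ hm.aemeasurable]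
  have hp : ((unitInterval.toNNReal p : ℝ≥0) : ℝ≥0∞) = ENNReal.ofReal p := by
    rw [ENNReal.ofReal, Real.toNNReal_of_nonneg p.2.1]; rfl
  have hq : ((unitInterval.toNNReal q : ℝ≥0) : ℝ≥0∞) = ENNReal.ofReal q := by
    rw [ENNReal.ofReal, Real.toNNReal_of_nonneg q.2.1]; rfl
  have hB : ∫⁻ m, (1 - weight α s K (x, FilePortion.B, m))
      ∂((bernoulliMeasure (1 : ℝ) 0 q).prod (expMeasure 1)) = 0 := by
    simp [weight, gainOutside, gain, hx]
  have hA : ∫⁻ m, (1 - weight α s K (x, FilePortion.A, m))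
      ∂((bernoulliMeasure (1 : ℝ) 0 q).prod (expMeasure 1)) =
      ENNReal.ofReal q * ENNReal.ofReal (pathLoss α s x) := by
    have hmA : Measurable fun m => 1 - weight α s K (x, FilePortion.A, m) :=
      hm.comp measurable_prodMk_left
    rw [lintegral_prod _ hmA.aemeasurable, bernoulliMeasure_def, lintegral_add_measure,
      lintegral_smul_measure, lintegral_smul_measure,
      lintegral_dirac' _ hmA.lintegral_prod_right', lintegral_dirac' _ hmA.lintegral_prod_right']
    have h0 : ∫⁻ h, (1 - weight α s K (x, FilePortion.A, 0, h)) ∂(expMeasure 1) = 0 := by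
      simp only [weight, gainOutside, gain]
      refine (lintegral_congr fun h => ?_).trans lintegral_zero
      rw [indicator_of_mem (by simpa using hx), indicator_of_mem (by simp)]
      simp
    have h1 : ∫⁻ h, (1 - weight α s K (x, FilePortion.A, 1, h)) ∂(expMeasure 1) =
        ENNReal.ofReal (pathLoss α s x) := by
      have hxp : 0 < ‖x‖ ^ α := Real.rpow_pos_of_pos (norm_pos_iff.2 hx0) _
      rw [show pathLoss α s x = (s * ‖x‖ ^ (-α)) / (1 + s * ‖x‖ ^ (-α)) by
        rw [pathLoss, Real.rpow_neg (norm_nonneg x)]; field_simp; ring,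
        ← lintegral_one_sub_exp_expMeasure (by positivity)]
      refine lintegral_congr fun h => ?_
      simp only [weight, gainOutside, gain]
      rw [indicator_of_mem (by simpa using hx), indicator_of_mem (by simp)]
      simp only [one_mul]
      congr 4
      ring
    rw [h0, h1, smul_zero, add_zero, ENNReal.smul_def, hq, smul_eq_mul]
  rw [bernoulliMeasure_def, lintegral_add_measure, lintegral_smul_measure, lintegral_smul_measure,
    lintegral_dirac' _ hm.lintegral_prod_right', lintegral_dirac' _ hm.lintegral_prod_right',
    hA, hB, smul_zero, add_zero, ENNReal.smul_def, hp, smul_eq_mul,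
    ← ENNReal.ofReal_mul q.2.1, ← ENNReal.ofReal_mul p.2.1, mul_assoc]

lemma lintegral_lintegral_one_sub_weight {α s : ℝ} (hα : 2 < α) (hs : 0 < s) (p q : I)
    {K : Set Plane} (hK : MeasurableSet K) :
    ∫⁻ x, ∫⁻ m, (1 - weight α s K (x, m)) ∂(markLaw p q) =
      ENNReal.ofReal (p * q * ∫ x in Kᶜ, pathLoss α s x) := by
  rw [← integral_const_mul, ofReal_integral_eq_lintegral_ofReal
      ((integrable_pathLoss hα hs).const_mul _).integrableOn
      (ae_of_all _ fun x => mul_nonneg (mul_nonneg p.2.1 q.2.1) (pathLoss_nonneg hs x)),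
    ← lintegral_indicator hK.compl]
  refine lintegral_congr_ae ?_
  filter_upwards [Measure.ae_ne volume (0 : Plane)] with x hx
  exact lintegral_one_sub_weight hs p q hK hx

/-- The Laplace transform at `s` of the interference from outside of `K`. -/
noncomputable def laplaceOutside (α s : ℝ) (lam : ℝ≥0) (p q : I) (K : Set Plane) : ℝ :=
  Real.exp (-((p : ℝ) * q * lam * ∫ x in Kᶜ, pathLoss α s x))

variable {Ω : Type*} [MeasurableSpace Ω] {P : Measure Ω} {lam : ℝ≥0} {p q : I} {N : Network Ω}

namespace Network.IsModel

lemma lintegral_expProd_weight (hN : N.IsModel P lam p q) {α s : ℝ} (hα : 2 < α) (hs : 0 < s)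
    {K : Set Plane} (hK : MeasurableSet K) :
    ∫⁻ ω, expProd (fun n => weight α s K (N.point n ω)) ∂P =
      ENNReal.ofReal (laplaceOutside α s lam p q K) := by
  have h := lintegral_lintegral_one_sub_weight hα hs p q hK
  rw [hN.lintegral_expProd (measurable_weight α s hK) (weight_le_one hs.le K)
    (by rw [h]; exact ENNReal.ofReal_ne_top), h, ENNReal.toReal_ofReal, laplaceOutside]
  · congr 2; ring
  · exact mul_nonneg (mul_nonneg p.2.1 q.2.1) (integral_nonneg fun x => pathLoss_nonneg hs x)

/-- Inside and outside decouple here: the void event concerns only points over `K`, while the weight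
is 1 over `K`. -/
lemma setLIntegral_avoid_weight (hN : N.IsModel P lam p q) {α s : ℝ} (hα : 2 < α) (hs : 0 < s)
    {K : Set Plane} (hK : MeasurableSet K) (hKfin : volume K ≠ ∞) {T : Set (Plane × Mark)}
    (hT : MeasurableSet T) (hTK : T ⊆ K ×ˢ univ) :
    ∫⁻ ω in N.avoid T, expProd (fun n => weight α s K (N.point n ω)) ∂P =
      P (N.avoid T) * ENNReal.ofReal (laplaceOutside α s lam p q K) := by
  rw [← hN.lintegral_expProd_weight hα hs hK]
  refine hN.setLIntegral_avoid hT ?_ (measurable_weight α s hK) (weight_le_one hs.le K) ?_ ?_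
  · refine ne_top_of_le_ne_top ?_ (measure_mono hTK)
    rw [Measure.prod_prod, measure_univ, mul_one]
    exact hKfin
  · rw [lintegral_lintegral_one_sub_weight hα hs p q hK]
    exact ENNReal.ofReal_ne_top
  · intro z hz
    have : z.1 ∈ K := (hTK hz).1
    simp [weight, gainOutside, this]

end Network.IsModel


/-! ### Almost sure properties of the network -/

/-- A nonvanishing product thus certifies summability, which is how `ae_summable_gain` uses it. -/
lemma expProd_exp_eq_zero {x : ℕ → ℝ} (hx : ∀ n, 0 ≤ x n) (hs : ¬ Summable x) :
    expProd (fun n => ENNReal.ofReal (Real.exp (-x n))) = 0 := by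
  refine tendsto_nhds_unique (tendsto_expProd fun n => ?_) ?_
  · simpa using hx n
  · simp_rw [← ENNReal.ofReal_prod_of_nonneg (fun n _ => (Real.exp_pos (-x n)).le),
      ← Real.exp_sum, Finset.sum_neg_distrib]
    rw [← ENNReal.ofReal_zero]
    exact (ENNReal.continuous_ofReal.tendsto _).comp (Real.tendsto_exp_neg_atTop_nhds_zero.comp
      ((not_summable_iff_tendsto_nat_atTop_of_nonneg hx).1 hs))

lemma tendsto_integral_pathLoss_zero {α : ℝ} (hα : 2 < α) :
    Tendsto (fun k : ℕ => ∫ x, pathLoss α (1 / ((k : ℝ) + 1)) x) atTop (𝓝 0) := by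
  rw [← integral_zero Plane ℝ (μ := volume)]
  refine tendsto_integral_of_dominated_convergence (pathLoss α 1)
    (fun k => (measurable_pathLoss α _).aestronglyMeasurable) (integrable_pathLoss hα one_pos)
    (fun k => ae_of_all _ fun x => ?_) ?_
  · rw [Real.norm_of_nonneg (pathLoss_nonneg (by positivity) x)]
    refine pathLoss_mono (by positivity) ?_ x
    rw [div_le_one (by positivity)]
    linarith [(Nat.cast_nonneg k : (0 : ℝ) ≤ k)]
  · filter_upwards [Measure.ae_ne volume (0 : Plane)] with x hx
    have hxp : 0 < ‖x‖ ^ α := Real.rpow_pos_of_pos (norm_pos_iff.2 hx) _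
    simp only [pathLoss, one_div, div_inv_eq_mul]
    refine tendsto_inv_atTop_zero.comp (tendsto_atTop_add_const_left _ _ ?_)
    exact (tendsto_atTop_add_const_right _ _ tendsto_natCast_atTop_atTop).const_mul_atTop hxp

lemma ae_markLaw_nonneg (p q : I) : ∀ᵐ m ∂(markLaw p q), 0 ≤ m.2.1 * m.2.2 := by
  have h1 : ∀ᵐ t ∂(bernoulliMeasure (1 : ℝ) 0 q), 0 ≤ t := by
    rw [bernoulliMeasure_def, ae_add_measure_iff]
    exact ⟨Measure.ae_smul_measure (by rw [ae_dirac_eq]; exact zero_le_one (α := ℝ)) _,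
      Measure.ae_smul_measure (by rw [ae_dirac_eq]; exact le_refl (0 : ℝ)) _⟩
  have h2 : ∀ᵐ h ∂(expMeasure 1), 0 ≤ h := by
    have : expMeasure 1 = volume.withDensity (exponentialPDF 1) := rfl
    rw [ae_iff, this, withDensity_apply' ]
    simp only [not_le]
    exact lintegral_exponentialPDF_of_nonpos le_rfl
  have h3 : ∀ᵐ m ∂((bernoulliMeasure (1 : ℝ) 0 q).prod (expMeasure 1)), 0 ≤ m.1 * m.2 := by
    filter_upwards [Measure.quasiMeasurePreserving_fst.ae h1,
      Measure.quasiMeasurePreserving_snd.ae h2] with m hm1 hm2 using mul_nonneg hm1 hm2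
  exact Measure.quasiMeasurePreserving_snd.ae h3

variable {Ω : Type*} [MeasurableSpace Ω] {P : Measure Ω} {lam : ℝ≥0} {p q : I} {N : Network Ω}

namespace Network

/-- The almost sure properties of the devices that are used below. -/
structure Regular (N : Network Ω) (α : ℝ) (ω : Ω) : Prop where
  finite : ∀ r : ℝ, {n | N.location n ω ∈ Metric.closedBall 0 r}.Finite
  exists_file : ∀ F, ∃ n, N.file n ω = F
  nonneg : ∀ n, 0 ≤ N.activity n ω * N.fading n ω
  summable : Summable fun n => gain α (N.point n ω)

namespace IsModel

/-- The product vanishes where the series diverges and is at most 1, so its mean bounds the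
probability of convergence from below. With `K` empty this mean tends to 1 as `s` tends to 0. A
first-moment bound would not do, since ‖x‖^(-α) is not integrable at the origin. -/
lemma ae_summable_gain (hN : N.IsModel P lam p q) {α : ℝ} (hα : 2 < α) :
    ∀ᵐ ω ∂P, Summable fun n => gain α (N.point n ω) := by
  have := hN.iIndepFun_mark.isProbabilityMeasure
  let S : Set Ω := {ω | ∑' n, ENNReal.ofReal (gain α (N.point n ω)) ≠ ∞}
  have hS : MeasurableSet S := by
    refine MeasurableSet.compl (measurableSet_eq_fun ?_ measurable_const)
    exact Measurable.tsum fun n =>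
      ((measurable_gain α).comp (hN.measurable_point n)).ennreal_ofReal
  have hG (k : ℕ) :
      ENNReal.ofReal (laplaceOutside α (1 / ((k : ℝ) + 1)) lam p q ∅) ≤ P S := by
    have hs : 0 < 1 / ((k : ℝ) + 1) := by positivity
    rw [← hN.lintegral_expProd_weight hα hs MeasurableSet.empty, ← lintegral_indicator_one hS]
    refine lintegral_mono fun ω => ?_
    by_cases hω : ω ∈ S
    · rw [indicator_of_mem hω]
      exact expProd_le_one _
    · rw [indicator_of_notMem hω]
      refine (expProd_exp_eq_zero (fun n => mul_nonneg hs.le (gainOutside_nonneg _ _ _))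
        fun hsum => hω ?_).le
      rw [summable_mul_left_iff hs.ne'] at hsum
      simp only [gainOutside, compl_empty, univ_prod_univ, indicator_univ] at hsum
      exact hsum.tsum_ofReal_ne_top
  have hlim : Tendsto (fun k : ℕ => ENNReal.ofReal
      (laplaceOutside α (1 / ((k : ℝ) + 1)) lam p q ∅)) atTop (𝓝 1) := by
    rw [← ENNReal.ofReal_one, ← Real.exp_zero, ← neg_zero, ← mul_zero ((p : ℝ) * q * lam)]
    refine (ENNReal.continuous_ofReal.tendsto _).comp ((Real.continuous_exp.tendsto _).comp
      (Tendsto.neg (Tendsto.const_mul _ ?_)))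
    simpa using tendsto_integral_pathLoss_zero hα
  have hPS : P S = 1 := le_antisymm prob_le_one (le_of_tendsto' hlim hG)
  filter_upwards [(prob_compl_eq_zero_iff hS).2 hPS] with ω hω
  have hω' : ω ∈ S := by simpa using hω
  exact (ENNReal.summable_toReal hω').congr fun n => ENNReal.toReal_ofReal (gain_nonneg _ _)

lemma ae_regular (hN : N.IsModel P lam p q) (hlam : 0 < lam) (hp0 : 0 < p) (hp1 : p < 1) {α : ℝ}
    (hα : 2 < α) : ∀ᵐ ω ∂P, N.Regular α ω := by
  have hfin : ∀ᵐ ω ∂P, ∀ k : ℕ, {n | N.location n ω ∈ Metric.closedBall 0 (k : ℝ)}.Finite :=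
    ae_all_iff.2 fun k => hN.ppp.ae_finite Metric.isClosed_closedBall.measurableSet
      measure_closedBall_lt_top.ne
  have hA : ∀ᵐ ω ∂P, ∃ n, N.file n ω = FilePortion.A := by
    refine hN.ae_exists_file hlam ?_
    rw [bernoulliMeasure_apply_of_mem_of_notMem p MeasurableSet.of_discrete
      (mem_singleton _) (by simp)]
    have h : unitInterval.toNNReal p ≠ 0 := fun h =>
      hp0.ne' (Subtype.ext (congr_arg NNReal.toReal h))
    simpa using h
  have hB : ∀ᵐ ω ∂P, ∃ n, N.file n ω = FilePortion.B := by
    refine hN.ae_exists_file hlam ?_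
    rw [bernoulliMeasure_apply_of_notMem_of_mem p MeasurableSet.of_discrete
      (by simp) (mem_singleton _)]
    have h : unitInterval.toNNReal (σ p) ≠ 0 := fun h =>
      (sub_pos.2 (show (p : ℝ) < 1 from hp1)).ne' (congr_arg NNReal.toReal h)
    simpa using h
  have hnn : ∀ᵐ ω ∂P, ∀ n, 0 ≤ N.activity n ω * N.fading n ω := ae_all_iff.2 fun n =>
    ae_of_ae_map (hN.measurable_mark n).aemeasurable
      (p := fun m : Mark => 0 ≤ m.2.1 * m.2.2)
      (by rw [(hN.hasLaw_mark n).map_eq]; exact ae_markLaw_nonneg p q)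
  filter_upwards [hfin, hA, hB, hnn, hN.ae_summable_gain hα] with ω h1 h2 h3 h4 h5
  refine ⟨fun r => ?_, fun F => by cases F <;> assumption, h4, h5⟩
  obtain ⟨k, hk⟩ := exists_nat_ge r
  exact (h1 k).subset fun n hn => Metric.closedBall_subset_closedBall hk hn

end IsModel

/-! ### Nearest-device distances, void discs and subcase `Y` -/

/-- The distance from `c` to the closest device that caches `F`. -/
noncomputable def fileDist (N : Network Ω) (F : FilePortion) (c : Plane) (ω : Ω) : ℝ :=
  Metric.infDist c {x | ∃ n, N.file n ω = F ∧ N.location n ω = x}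

/-- The marked points that cache `F` and lie in a closed disc. -/
def fileDisc (F : FilePortion) (c : Plane) (t : ℝ) : Set (Plane × Mark) :=
  {z | z.1 ∈ Metric.closedBall c t} ∩ {z | z.2.1 = F}

lemma measurableSet_fileDisc (F : FilePortion) (c : Plane) (t : ℝ) :
    MeasurableSet (fileDisc F c t) :=
  (Metric.isClosed_closedBall.measurableSet.preimage measurable_fst).inter (measurableSet_file F)

lemma fileDisc_mono (F : FilePortion) (c : Plane) {s t : ℝ} (hst : s ≤ t) :
    fileDisc F c s ⊆ fileDisc F c t :=
  fun _ hz => ⟨Metric.closedBall_subset_closedBall hst hz.1, hz.2⟩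

omit [MeasurableSpace Ω] in
lemma fileDist_nonneg (N : Network Ω) (F : FilePortion) (c : Plane) (ω : Ω) :
    0 ≤ N.fileDist F c ω := Metric.infDist_nonneg

omit [MeasurableSpace Ω] in
lemma fileDist_le {F : FilePortion} (c : Plane) {ω : Ω} {n : ℕ} (hn : N.file n ω = F) :
    N.fileDist F c ω ≤ dist (N.location n ω) c := by
  rw [dist_comm]
  exact Metric.infDist_le_dist_of_mem ⟨n, hn, rfl⟩

lemma IsModel.measurable_file (hN : N.IsModel P lam p q) (n : ℕ) : Measurable (N.file n) :=
  measurable_fst.comp (hN.measurable_mark n)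

lemma IsModel.measurable_fileDist (hN : N.IsModel P lam p q) (F : FilePortion) (c : Plane) :
    Measurable (N.fileDist F c) := by
  classical
  -- A countable infimum of extended distances, with `∞` for devices not caching `F`. If no device
  -- caches `F`, both sides are 0 by the convention for `toReal`.
  have h : N.fileDist F c = fun ω =>
      (⨅ n, if N.file n ω = F then edist c (N.location n ω) else ∞).toReal := by
    funext ω
    refine congr_arg ENNReal.toReal (le_antisymm (le_iInf fun n => ?_) ?_)
    · split_ifs with hn
      · exact Metric.infEDist_le_edist_of_mem ⟨n, hn, rfl⟩
      · exact le_top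
    · refine Metric.le_infEDist.2 ?_
      rintro _ ⟨n, hn, rfl⟩
      exact (iInf_le _ n).trans (by rw [if_pos hn])
  rw [h]
  refine (Measurable.iInf fun n => Measurable.ite ?_ ?_ measurable_const).ennreal_toReal
  · exact (MeasurableSet.of_discrete (s := {F})).preimage (hN.measurable_file n)
  · exact measurable_const.edist (hN.ppp.measurable n)

namespace Regular

omit [MeasurableSpace Ω]

variable {α : ℝ} {ω : Ω}

/-- Local finiteness makes the infimum a minimum: only finitely many devices are at least as close
as a given one. -/
lemma exists_fileDist_eq (h : N.Regular α ω) (F : FilePortion) (c : Plane) :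
    ∃ n, N.file n ω = F ∧ dist (N.location n ω) c = N.fileDist F c ω := by
  obtain ⟨n₀, hn₀⟩ := h.exists_file F
  set d := dist (N.location n₀ ω) c with hd
  let s : Set ℕ := {n | N.file n ω = F ∧ dist (N.location n ω) c ≤ d}
  have hs : s.Finite := (h.finite (d + dist c 0)).subset fun n hn => by
    have := dist_triangle (N.location n ω) c 0
    have := hn.2
    simp only [mem_ofPred_eq, Metric.mem_closedBall]
    linarith
  obtain ⟨n, hn, hmin⟩ := hs.exists_minimalFor (fun n => dist (N.location n ω) c) s
    ⟨n₀, hn₀, le_rfl⟩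
  have hmin' (m) (hm : N.file m ω = F) : dist (N.location n ω) c ≤ dist (N.location m ω) c := by
    rcases le_total (dist (N.location n ω) c) (dist (N.location m ω) c) with h1 | h1
    · exact h1
    · exact hmin ⟨hm, h1.trans hn.2⟩ h1
  refine ⟨n, hn.1, le_antisymm ?_ (fileDist_le c hn.1)⟩
  refine (Metric.le_infDist (s := {x | ∃ n, N.file n ω = F ∧ N.location n ω = x})
    ⟨N.location n ω, n, hn.1, rfl⟩).2 ?_
  rintro _ ⟨m, hm, rfl⟩
  rw [dist_comm c]
  exact hmin' m hm

/-- Translates distance events into void events. Since the minimum is attained, a strict inequality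
corresponds to a void closed disc. -/
lemma lt_fileDist_iff (h : N.Regular α ω) {F : FilePortion} {c : Plane} {t : ℝ} :
    t < N.fileDist F c ω ↔ ω ∈ N.avoid (fileDisc F c t) := by
  refine ⟨fun ht n hn => ?_, fun ht => ?_⟩
  · exact (ht.trans_le (fileDist_le c hn.2)).not_ge hn.1
  · obtain ⟨n, hn, hd⟩ := h.exists_fileDist_eq F c
    rw [← hd]
    by_contra hcon
    exact ht n ⟨not_lt.1 hcon, hn⟩

/-- The inequality is not strict because a tie between a nearest `A` and a nearest `B` counts as
subcase `Y`. -/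
lemma mem_subcaseY_iff (h : N.Regular α ω) {v : ℝ} :
    ω ∈ N.subcaseY v ↔
      N.fileDist FilePortion.B (loc1 v) ω ≤ N.fileDist FilePortion.A (loc1 v) ω := by
  constructor
  · rintro ⟨n, hn, hmin⟩
    obtain ⟨m, _, hmd⟩ := h.exists_fileDist_eq FilePortion.A (loc1 v)
    rw [← hmd]
    exact (fileDist_le _ hn).trans (hmin m)
  · intro hle
    obtain ⟨n, hn, hd⟩ := h.exists_fileDist_eq FilePortion.B (loc1 v)
    refine ⟨n, hn, fun m => ?_⟩
    rw [hd]
    cases hm : N.file m ω with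
    | A => exact hle.trans (fileDist_le _ hm)
    | B => exact fileDist_le _ hm

end Regular

omit [MeasurableSpace Ω] in
lemma R1_eq_fileDist {v : ℝ} {ω : Ω} (hω : ω ∈ N.subcaseY v) :
    N.R1 v ω = N.fileDist FilePortion.B (loc1 v) ω := by
  obtain ⟨n, hn, hmin⟩ := hω
  refine le_antisymm ?_ ?_
  · refine Metric.infDist_le_infDist_of_subset ?_ ⟨_, n, hn, rfl⟩
    rintro _ ⟨m, _, rfl⟩
    exact ⟨m, rfl⟩
  · refine (Metric.le_infDist (range_nonempty fun n => N.location n ω)).2 ?_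
    rintro _ ⟨m, rfl⟩
    rw [dist_comm]
    exact (fileDist_le _ hn).trans (hmin m)

lemma IsModel.measurableSet_subcaseY (hN : N.IsModel P lam p q) (v : ℝ) :
    MeasurableSet (N.subcaseY v) := by
  have : N.subcaseY v = ⋃ n, N.file n ⁻¹' {FilePortion.B} ∩
      ⋂ m, {ω | dist (N.location n ω) (loc1 v) ≤ dist (N.location m ω) (loc1 v)} := by
    ext ω; simp [subcaseY]
  rw [this]
  exact .iUnion fun n => ((MeasurableSet.of_discrete).preimage (hN.measurable_file n)).inter <|
    .iInter fun m => measurableSet_le ((hN.ppp.measurable n).dist measurable_const)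
      ((hN.ppp.measurable m).dist measurable_const)

end Network


/-! ### The discretized interference -/

lemma natCeil_eq_iff {x : ℝ} (hx : 0 ≤ x) (i : ℕ) : ⌈x⌉₊ = i ↔ (i : ℝ) - 1 < x ∧ x ≤ i := by
  constructor
  · rintro rfl
    exact ⟨by linarith [Nat.ceil_lt_add_one hx], Nat.le_ceil x⟩
  · rintro ⟨h1, h2⟩
    refine le_antisymm (Nat.ceil_le.2 h2) (Nat.le_of_lt_succ ?_)
    have := Nat.le_ceil x
    exact_mod_cast (show (i : ℝ) < (⌈x⌉₊ + 1 : ℝ) by linarith)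

/-- The smallest multiple of `δ` above `x`. -/
noncomputable def roundUp (δ x : ℝ) : ℝ := ⌈x / δ⌉₊ * δ

lemma le_roundUp {δ : ℝ} (hδ : 0 < δ) (x : ℝ) : x ≤ roundUp δ x := by
  have := Nat.le_ceil (x / δ)
  rwa [div_le_iff₀ hδ] at this

lemma roundUp_lt {δ x : ℝ} (hδ : 0 < δ) (hx : 0 ≤ x) : roundUp δ x < x + δ := by
  have := Nat.ceil_lt_add_one (div_nonneg hx hδ.le)
  calc roundUp δ x < (x / δ + 1) * δ := mul_lt_mul_of_pos_right this hδ
    _ = x + δ := by field_simp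

lemma natCeil_div_eq_iff {δ x : ℝ} (hδ : 0 < δ) (hx : 0 ≤ x) (i : ℕ) :
    ⌈x / δ⌉₊ = i ↔ i * δ - δ < x ∧ x ≤ i * δ := by
  rw [natCeil_eq_iff (div_nonneg hx hδ.le), lt_div_iff₀ hδ, div_le_iff₀ hδ, sub_one_mul]

/-- The union of the discs `C₁` and `C₂`. -/
noncomputable def discs (v : ℝ) (r : ℝ × ℝ) : Set Plane :=
  Metric.closedBall (Network.loc1 v) r.1 ∪ Metric.closedBall 0 r.2

lemma measurableSet_discs (v : ℝ) (r : ℝ × ℝ) : MeasurableSet (discs v r) :=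
  Metric.isClosed_closedBall.measurableSet.union Metric.isClosed_closedBall.measurableSet

lemma measurableSet_mem_discs (v : ℝ) :
    MeasurableSet {z : (ℝ × ℝ) × Plane | z.2 ∈ discs v z.1} := by
  have : {z : (ℝ × ℝ) × Plane | z.2 ∈ discs v z.1} =
      {z | dist z.2 (Network.loc1 v) ≤ z.1.1} ∪ {z | dist z.2 0 ≤ z.1.2} := rfl
  rw [this]
  exact (measurableSet_le (by fun_prop) (by fun_prop)).union
    (measurableSet_le (by fun_prop) (by fun_prop))

lemma measurable_weight_discs (α s v : ℝ) :
    Measurable fun z : (ℝ × ℝ) × (Plane × Mark) => weight α s (discs v z.1) z.2 := by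
  have h : (fun z : (ℝ × ℝ) × (Plane × Mark) => gainOutside α (discs v z.1) z.2) =
      {z : (ℝ × ℝ) × (Plane × Mark) | z.2.1 ∈ discs v z.1}ᶜ.indicator fun z => gain α z.2 := by
    funext z
    by_cases hz : z.2.1 ∈ discs v z.1 <;> simp [gainOutside, hz, indicator]
  have hm : Measurable fun z : (ℝ × ℝ) × (Plane × Mark) => gainOutside α (discs v z.1) z.2 := by
    rw [h]
    exact ((measurable_gain α).comp measurable_snd).indicator
      (((measurableSet_mem_discs v).preimage
        (f := fun z : (ℝ × ℝ) × (Plane × Mark) => (z.1, z.2.1)) (by fun_prop)).compl)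
  exact (hm.const_mul s).neg.exp.ennreal_ofReal

lemma measurable_laplaceOutside_discs (α s v : ℝ) (lam : ℝ≥0) (p q : I) :
    Measurable fun r => laplaceOutside α s lam p q (discs v r) := by
  have h (r : ℝ × ℝ) : ∫ x in (discs v r)ᶜ, pathLoss α s x =
      ∫ x, {z : (ℝ × ℝ) × Plane | z.2 ∈ discs v z.1}ᶜ.indicator
        (fun z => pathLoss α s z.2) (r, x) := by
    rw [← integral_indicator (measurableSet_discs v r).compl]
    rfl
  have hm : Measurable ({z : (ℝ × ℝ) × Plane | z.2 ∈ discs v z.1}ᶜ.indicator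
      (fun z => pathLoss α s z.2)) :=
    ((measurable_pathLoss α s).comp measurable_snd).indicator (measurableSet_mem_discs v).compl
  unfold laplaceOutside
  simp_rw [h]
  exact (hm.stronglyMeasurable.integral_prod_right'.measurable.const_mul _).neg.exp

lemma laplaceOutside_le_one {α s : ℝ} (hs : 0 < s) (lam : ℝ≥0) (p q : I) (K : Set Plane) :
    laplaceOutside α s lam p q K ≤ 1 := by
  rw [laplaceOutside, Real.exp_le_one_iff, neg_nonpos]
  exact mul_nonneg (mul_nonneg (mul_nonneg p.2.1 q.2.1) lam.2)
    (integral_nonneg fun x => pathLoss_nonneg hs x)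

/-- Carries the agreement of two finite measures from void events to the grid cells, which are
differences of such events. -/
lemma measure_diff_congr {E : Type*} [MeasurableSpace E] {μ ν : Measure E} [IsFiniteMeasure μ]
    [IsFiniteMeasure ν] {S T : Set E} (hT : MeasurableSet T) (hTS : T ⊆ S) (hS' : μ S = ν S)
    (hT' : μ T = ν T) : μ (S \ T) = ν (S \ T) := by
  rw [measure_sdiff hTS hT.nullMeasurableSet (measure_ne_top _ _),
    measure_sdiff hTS hT.nullMeasurableSet (measure_ne_top _ _), hS', hT']

variable {Ω : Type*} [MeasurableSpace Ω] {P : Measure Ω} {lam : ℝ≥0} {p q : I} {N : Network Ω}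

namespace Network

omit [MeasurableSpace Ω] in
lemma avoid_anti (N : Network Ω) {S T : Set (Plane × Mark)} (h : S ⊆ T) :
    N.avoid T ⊆ N.avoid S := fun _ hω n hn => hω n (h hn)

omit [MeasurableSpace Ω] in
lemma avoid_union (N : Network Ω) (S T : Set (Plane × Mark)) :
    N.avoid (S ∪ T) = N.avoid S ∩ N.avoid T := by
  ext ω
  simp [avoid, forall_and]

/-- The distances from location 1 to the closest device caching `B` and from the origin to the
closest device caching `A`. -/
noncomputable def dists (N : Network Ω) (v : ℝ) (ω : Ω) : ℝ × ℝ :=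
  (N.fileDist FilePortion.B (loc1 v) ω, N.fileDist FilePortion.A 0 ω)

/-- A discretized version of subcase `Y`. -/
def approxY (N : Network Ω) (v δ : ℝ) : Set Ω :=
  {ω | roundUp δ (N.dists v ω).1 - δ < N.fileDist FilePortion.A (loc1 v) ω}

/-- The event that the two distances lie in a given cell of the grid. -/
def cell (N : Network Ω) (v δ : ℝ) (ij : ℕ × ℕ) : Set Ω :=
  {ω | ⌈(N.dists v ω).1 / δ⌉₊ = ij.1} ∩ {ω | ⌈(N.dists v ω).2 / δ⌉₊ = ij.2}

namespace IsModel

lemma measurable_dists (hN : N.IsModel P lam p q) (v : ℝ) : Measurable (N.dists v) :=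
  (hN.measurable_fileDist _ _).prodMk (hN.measurable_fileDist _ _)

lemma measurableSet_approxY (hN : N.IsModel P lam p q) (v δ : ℝ) :
    MeasurableSet (N.approxY v δ) := by
  refine measurableSet_lt (Measurable.sub_const ?_ _) (hN.measurable_fileDist _ _)
  exact (measurable_from_nat.comp (Nat.measurable_ceil.comp
    ((hN.measurable_dists v).fst.div_const δ))).mul_const δ

lemma measurableSet_cell (hN : N.IsModel P lam p q) (v δ : ℝ) (ij : ℕ × ℕ) :
    MeasurableSet (N.cell v δ ij) :=
  ((measurableSet_singleton ij.1).preimage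
    (Nat.measurable_ceil.comp ((hN.measurable_dists v).fst.div_const δ))).inter
  ((measurableSet_singleton ij.2).preimage
    (Nat.measurable_ceil.comp ((hN.measurable_dists v).snd.div_const δ)))

lemma measurable_expProd_weight (hN : N.IsModel P lam p q) (α s v : ℝ) {R : Ω → ℝ × ℝ}
    (hR : Measurable R) :
    Measurable fun ω => expProd fun n => weight α s (discs v (R ω)) (N.point n ω) :=
  measurable_expProd (u := fun n ω => weight α s (discs v (R ω)) (N.point n ω)) fun n =>
    Measurable.comp (g := fun z : (ℝ × ℝ) × (Plane × Mark) => weight α s (discs v z.1) z.2)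
      (f := fun ω => (R ω, N.point n ω))
      (measurable_weight_discs α s v) (hR.prodMk (hN.measurable_point n))

end IsModel

/-- The marked points that are avoided when the distances exceed `t` and `u`, and no device
caching `A` is within `d` of location 1. -/
def forbidden (v d t u : ℝ) : Set (Plane × Mark) :=
  fileDisc FilePortion.A (loc1 v) d ∪ fileDisc FilePortion.B (loc1 v) t ∪
    fileDisc FilePortion.A 0 u

lemma measurableSet_forbidden (v d t u : ℝ) : MeasurableSet (forbidden v d t u) :=
  ((measurableSet_fileDisc _ _ _).union (measurableSet_fileDisc _ _ _)).union
    (measurableSet_fileDisc _ _ _)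

/-- This is why distances are rounded up: every void condition describing a cell concerns points
inside the rounded discs. -/
lemma forbidden_subset (v : ℝ) {d t u a b : ℝ} (hd : d ≤ a) (ht : t ≤ a) (hu : u ≤ b) :
    forbidden v d t u ⊆ discs v (a, b) ×ˢ univ := by
  rintro z ((hz | hz) | hz)
  · exact ⟨.inl (Metric.closedBall_subset_closedBall hd hz.1), trivial⟩
  · exact ⟨.inl (Metric.closedBall_subset_closedBall ht hz.1), trivial⟩
  · exact ⟨.inr (Metric.closedBall_subset_closedBall hu hz.1), trivial⟩

lemma forbidden_mono (v d : ℝ) {t t' u u' : ℝ} (ht : t ≤ t') (hu : u ≤ u') :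
    forbidden v d t u ⊆ forbidden v d t' u' :=
  union_subset_union (union_subset_union le_rfl (fileDisc_mono _ _ ht)) (fileDisc_mono _ _ hu)

omit [MeasurableSpace Ω] in
lemma mem_avoid_forbidden {α : ℝ} {ω : Ω} (hω : N.Regular α ω) (v d t u : ℝ) :
    ω ∈ N.avoid (forbidden v d t u) ↔ (d < N.fileDist FilePortion.A (loc1 v) ω ∧
      t < (N.dists v ω).1) ∧ u < (N.dists v ω).2 := by
  rw [forbidden, avoid_union, avoid_union, mem_inter_iff, mem_inter_iff, dists,
    hω.lt_fileDist_iff, hω.lt_fileDist_iff, hω.lt_fileDist_iff]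

omit [MeasurableSpace Ω] in
lemma mem_approxY_inter_cell {v δ : ℝ} (hδ : 0 < δ) (ij : ℕ × ℕ) (ω : Ω) :
    ω ∈ N.approxY v δ ∩ N.cell v δ ij ↔
      ij.1 * δ - δ < N.fileDist FilePortion.A (loc1 v) ω ∧
      (ij.1 * δ - δ < (N.dists v ω).1 ∧ (N.dists v ω).1 ≤ ij.1 * δ) ∧
      (ij.2 * δ - δ < (N.dists v ω).2 ∧ (N.dists v ω).2 ≤ ij.2 * δ) := by
  have h1 : 0 ≤ (N.dists v ω).1 := N.fileDist_nonneg _ _ _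
  have h2 : 0 ≤ (N.dists v ω).2 := N.fileDist_nonneg _ _ _
  rw [← natCeil_div_eq_iff hδ h1 ij.1, ← natCeil_div_eq_iff hδ h2 ij.2]
  constructor
  · rintro ⟨hY, hi, hj⟩
    have hi' : ⌈(N.dists v ω).1 / δ⌉₊ = ij.1 := hi
    exact ⟨by rw [← hi']; exact hY, hi, hj⟩
  · rintro ⟨hY, hi, hj⟩
    exact ⟨by rw [← hi] at hY; exact hY, hi, hj⟩

-- Each inner difference confines the first distance to (a - δ, a]; removing the part with second
-- distance above `b` confines the second one to (b - δ, b].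
omit [MeasurableSpace Ω] in
lemma mem_approxY_inter_cell_iff_avoid {α : ℝ} {ω : Ω} (hω : N.Regular α ω) (v : ℝ) {δ : ℝ}
    (hδ : 0 < δ) (ij : ℕ × ℕ) {a b : ℝ} (ha : a = ij.1 * δ) (hb : b = ij.2 * δ) :
    ω ∈ N.approxY v δ ∩ N.cell v δ ij ↔
      ω ∈ (N.avoid (forbidden v (a - δ) (a - δ) (b - δ)) \
          N.avoid (forbidden v (a - δ) a (b - δ))) \
        (N.avoid (forbidden v (a - δ) (a - δ) b) \ N.avoid (forbidden v (a - δ) a b)) := by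
  rw [mem_approxY_inter_cell hδ, ← ha, ← hb]
  simp only [Set.mem_sdiff, mem_avoid_forbidden hω, ← not_lt]
  have hc : b < (N.dists v ω).2 → b - δ < (N.dists v ω).2 := fun h => by linarith
  tauto

namespace IsModel

/-- Compare `P` weighted by the interference factor with `P` scaled by its mean. Both are finite
measures that agree on the void events `H t u` with t ≤ a and u ≤ b, hence on the nested differences
that form the cell. -/
lemma setLIntegral_cell (hN : N.IsModel P lam p q) {α : ℝ} (hα : 2 < α)
    (hreg : ∀ᵐ ω ∂P, N.Regular α ω) (v : ℝ) {δ s : ℝ} (hδ : 0 < δ) (hs : 0 < s) (ij : ℕ × ℕ) :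
    ∫⁻ ω in N.approxY v δ ∩ N.cell v δ ij,
        expProd (fun n => weight α s (discs v (ij.1 * δ, ij.2 * δ)) (N.point n ω)) ∂P =
      P (N.approxY v δ ∩ N.cell v δ ij) *
        ENNReal.ofReal (laplaceOutside α s lam p q (discs v (ij.1 * δ, ij.2 * δ))) := by
  have := hN.iIndepFun_mark.isProbabilityMeasure
  obtain ⟨a, ha⟩ : ∃ a, a = ij.1 * δ := ⟨_, rfl⟩
  obtain ⟨b, hb⟩ : ∃ b, b = ij.2 * δ := ⟨_, rfl⟩
  rw [← ha, ← hb]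
  have hK : MeasurableSet (discs v (a, b)) := measurableSet_discs _ _
  have hKfin : volume (discs v (a, b)) ≠ ∞ :=
    ((measure_union_le _ _).trans_lt
      (ENNReal.add_lt_top.2 ⟨measure_closedBall_lt_top, measure_closedBall_lt_top⟩)).ne
  let μ : Measure Ω := P.withDensity fun ω =>
    expProd fun n => weight α s (discs v (a, b)) (N.point n ω)
  let ν : Measure Ω := ENNReal.ofReal (laplaceOutside α s lam p q (discs v (a, b))) • P
  have : IsFiniteMeasure μ := isFiniteMeasure_withDensity
    (((lintegral_mono fun ω => expProd_le_one _).trans_lt (by simp)).ne)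
  have : IsFiniteMeasure ν := ⟨by simp [ν]⟩
  let H (t u : ℝ) : Set Ω := N.avoid (forbidden v (a - δ) t u)
  have hHm (t u) : MeasurableSet (H t u) :=
    hN.measurableSet_avoid (measurableSet_forbidden _ _ _ _)
  have hH {t u : ℝ} (ht : t ≤ a) (hu : u ≤ b) : μ (H t u) = ν (H t u) := by
    rw [withDensity_apply _ (hHm t u), hN.setLIntegral_avoid_weight hα hs hK hKfin
      (measurableSet_forbidden _ _ _ _) (forbidden_subset v (by linarith) ht hu), mul_comm]
    rfl
  have hsub {t t' u u' : ℝ} (ht : t ≤ t') (hu : u ≤ u') : H t' u' ⊆ H t u :=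
    N.avoid_anti (forbidden_mono v _ ht hu)
  have hD {u : ℝ} (hu : u ≤ b) : μ (H (a - δ) u \ H a u) = ν (H (a - δ) u \ H a u) :=
    measure_diff_congr (hHm _ _) (hsub (by linarith) le_rfl) (hH (by linarith) hu) (hH le_rfl hu)
  have hset : (N.approxY v δ ∩ N.cell v δ ij : Set Ω) =ᵐ[P]
      ((H (a - δ) (b - δ) \ H a (b - δ)) \ (H (a - δ) b \ H a b) : Set Ω) := by
    refine eventuallyEq_set.2 ?_
    filter_upwards [hreg] with ω hω
    exact mem_approxY_inter_cell_iff_avoid hω v hδ ij ha hb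
  have hmeas : MeasurableSet (N.approxY v δ ∩ N.cell v δ ij) :=
    (hN.measurableSet_approxY v δ).inter (hN.measurableSet_cell v δ ij)
  have hμν : μ (N.approxY v δ ∩ N.cell v δ ij) = ν (N.approxY v δ ∩ N.cell v δ ij) := by
    have hμac : μ ≪ P := withDensity_absolutelyContinuous _ _
    have hνac : ν ≪ P := Measure.smul_absolutelyContinuous
    rw [measure_congr (hμac.ae_le hset), measure_congr (hνac.ae_le hset)]
    refine measure_diff_congr ((hHm _ _).diff (hHm _ _)) ?_ (hD (by linarith)) (hD le_rfl)
    -- Nesting of the two differences: an outcome in both `H (a - δ) b` and `H a (b - δ)` satisfies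
    -- all void conditions of `H a b`.
    rintro ω ⟨h1, h2⟩
    refine ⟨hsub le_rfl (by linarith) h1, fun h3 => h2 ?_⟩
    simp only [H, forbidden, avoid_union, mem_inter_iff] at h1 h3 ⊢
    exact ⟨h3.1, h1.2⟩
  rw [withDensity_apply _ hmeas] at hμν
  rw [hμν, mul_comm]
  rfl

/-- The discretized interference is conditionally independent of the discretized distances. -/
lemma setLIntegral_approxY (hN : N.IsModel P lam p q) {α : ℝ} (hα : 2 < α)
    (hreg : ∀ᵐ ω ∂P, N.Regular α ω) (v : ℝ) {δ s : ℝ} (hδ : 0 < δ) (hs : 0 < s)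
    (h : ℝ × ℝ → ℝ≥0∞) :
    ∫⁻ ω in N.approxY v δ, h ((roundUp δ (N.dists v ω).1), roundUp δ (N.dists v ω).2) *
        expProd (fun n => weight α s
          (discs v (roundUp δ (N.dists v ω).1, roundUp δ (N.dists v ω).2)) (N.point n ω)) ∂P =
      ∫⁻ ω in N.approxY v δ, h ((roundUp δ (N.dists v ω).1), roundUp δ (N.dists v ω).2) *
        ENNReal.ofReal (laplaceOutside α s lam p q
          (discs v (roundUp δ (N.dists v ω).1, roundUp δ (N.dists v ω).2))) ∂P := by
  have hU : N.approxY v δ = ⋃ ij, N.approxY v δ ∩ N.cell v δ ij := by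
    rw [← inter_iUnion, (eq_univ_iff_forall.2 fun ω => mem_iUnion.2
      ⟨(⌈(N.dists v ω).1 / δ⌉₊, ⌈(N.dists v ω).2 / δ⌉₊), rfl, rfl⟩ :
        ⋃ ij, N.cell v δ ij = univ), inter_univ]
  have hmeas (ij) : MeasurableSet (N.approxY v δ ∩ N.cell v δ ij) :=
    (hN.measurableSet_approxY v δ).inter (hN.measurableSet_cell v δ ij)
  have hdisj : Pairwise fun ij kl => Disjoint (N.approxY v δ ∩ N.cell v δ ij)
      (N.approxY v δ ∩ N.cell v δ kl) := by
    intro ij kl hne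
    refine disjoint_left.2 ?_
    rintro ω ⟨-, h1, h2⟩ ⟨-, h3, h4⟩
    exact hne (Prod.ext ((show _ = ij.1 from h1).symm.trans h3)
      ((show _ = ij.2 from h2).symm.trans h4))
  -- On each of the countably many cells the rounded distances are constant, so `h` and the Laplace
  -- transform leave the integral.
  rw [hU, lintegral_iUnion hmeas hdisj, lintegral_iUnion hmeas hdisj]
  refine tsum_congr fun ij => ?_
  have hround {ω : Ω} (hω : ω ∈ N.approxY v δ ∩ N.cell v δ ij) :
      (roundUp δ (N.dists v ω).1, roundUp δ (N.dists v ω).2) = (ij.1 * δ, ij.2 * δ) := by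
    obtain ⟨-, h1, h2⟩ := hω
    rw [roundUp, roundUp, show ⌈(N.dists v ω).1 / δ⌉₊ = ij.1 from h1,
      show ⌈(N.dists v ω).2 / δ⌉₊ = ij.2 from h2]
  have h1 := setLIntegral_congr_fun (μ := P) (hmeas ij)
    (f := fun ω => h (roundUp δ (N.dists v ω).1, roundUp δ (N.dists v ω).2) *
      expProd (fun n => weight α s
        (discs v (roundUp δ (N.dists v ω).1, roundUp δ (N.dists v ω).2)) (N.point n ω)))
    (g := fun ω => h (ij.1 * δ, ij.2 * δ) *
      expProd (fun n => weight α s (discs v (ij.1 * δ, ij.2 * δ)) (N.point n ω)))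
    (fun ω hω => by simp only [hround hω])
  have h2 := setLIntegral_congr_fun (μ := P) (hmeas ij)
    (f := fun ω => h (roundUp δ (N.dists v ω).1, roundUp δ (N.dists v ω).2) *
      ENNReal.ofReal (laplaceOutside α s lam p q
        (discs v (roundUp δ (N.dists v ω).1, roundUp δ (N.dists v ω).2))))
    (g := fun _ => h (ij.1 * δ, ij.2 * δ) *
      ENNReal.ofReal (laplaceOutside α s lam p q (discs v (ij.1 * δ, ij.2 * δ))))
    (fun ω hω => by simp only [hround hω])
  rw [h1, h2, lintegral_const_mul _ (hN.measurable_expProd_weight α s v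
      (R := fun _ => (ij.1 * δ, ij.2 * δ)) measurable_const),
    hN.setLIntegral_cell hα hreg v hδ hs ij, setLIntegral_const]
  ring

end IsModel

end Network


/-! ### Refining the grid -/

lemma tendsto_roundUp {δ : ℕ → ℝ} (hδ : ∀ k, 0 < δ k) (hlim : Tendsto δ atTop (𝓝 0)) {x : ℝ}
    (hx : 0 ≤ x) : Tendsto (fun k => roundUp (δ k) x) atTop (𝓝 x) := by
  refine tendsto_of_tendsto_of_tendsto_of_le_of_le (tendsto_const_nhds (x := x))
    (h := fun k => x + δ k) ?_ (fun k => le_roundUp (hδ k) x) (fun k => (roundUp_lt (hδ k) hx).le)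
  simpa using hlim.const_add x

/-- The radii approach their limits from above and the discs are closed: points inside stay inside,
and points outside are farther away than the limiting radii by a positive margin. -/
lemma eventually_mem_discs_iff {v : ℝ} {r : ℝ × ℝ} {R : ℕ → ℝ × ℝ} (hle : ∀ k, r ≤ R k)
    (hR : Tendsto R atTop (𝓝 r)) (x : Plane) :
    ∀ᶠ k in atTop, (x ∈ discs v (R k) ↔ x ∈ discs v r) := by
  have h1 : Tendsto (fun k => (R k).1) atTop (𝓝 r.1) := (continuous_fst.tendsto _).comp hR
  have h2 : Tendsto (fun k => (R k).2) atTop (𝓝 r.2) := (continuous_snd.tendsto _).comp hR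
  by_cases hx : x ∈ discs v r
  · refine Eventually.of_forall fun k => iff_of_true ?_ hx
    exact hx.imp (fun h => Metric.closedBall_subset_closedBall (hle k).1 h)
      fun h => Metric.closedBall_subset_closedBall (hle k).2 h
  · have hx1 : r.1 < dist x (Network.loc1 v) := not_le.1 fun h => hx (.inl h)
    have hx2 : r.2 < dist x 0 := not_le.1 fun h => hx (.inr h)
    filter_upwards [h1.eventually_lt_const hx1, h2.eventually_lt_const hx2] with k hk1 hk2
    exact iff_of_false (fun h => h.elim hk1.not_ge hk2.not_ge) hx

lemma tendsto_laplaceOutside {α s v : ℝ} (hα : 2 < α) (hs : 0 < s) (lam : ℝ≥0) (p q : I)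
    {r : ℝ × ℝ} {R : ℕ → ℝ × ℝ} (hle : ∀ k, r ≤ R k) (hR : Tendsto R atTop (𝓝 r)) :
    Tendsto (fun k => laplaceOutside α s lam p q (discs v (R k))) atTop
      (𝓝 (laplaceOutside α s lam p q (discs v r))) := by
  refine (Real.continuous_exp.tendsto _).comp (Tendsto.neg (Tendsto.const_mul _ ?_))
  simp_rw [← integral_indicator (measurableSet_discs v _).compl]
  refine tendsto_integral_of_dominated_convergence (pathLoss α s)
    (fun k => ((measurable_pathLoss α s).indicator
      (measurableSet_discs v _).compl).aestronglyMeasurable)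
    (integrable_pathLoss hα hs) (fun k => ae_of_all _ fun x => ?_) (ae_of_all _ fun x => ?_)
  · rw [Real.norm_of_nonneg (indicator_nonneg (fun _ _ => pathLoss_nonneg hs _) x)]
    exact indicator_le_self' (fun _ _ => pathLoss_nonneg hs _) x
  · refine tendsto_const_nhds.congr' ?_
    filter_upwards [eventually_mem_discs_iff (v := v) hle hR x] with k hk
    by_cases hx : x ∈ discs v r
    · rw [indicator_of_notMem (by simpa using hx), indicator_of_notMem (by simpa using hk.2 hx)]
    · rw [indicator_of_mem (by exact hx), indicator_of_mem (by exact fun h => hx (hk.1 h))]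

namespace Network

variable {Ω : Type*} {N : Network Ω}

namespace Regular

variable {α : ℝ} {ω : Ω}

lemma summable_gainOutside (h : N.Regular α ω) (K : Set Plane) :
    Summable fun n => gainOutside α K (N.point n ω) :=
  h.summable.of_nonneg_of_le (fun _ => gainOutside_nonneg _ _ _) fun _ => gainOutside_le _ _ _

lemma expProd_weight (h : N.Regular α ω) {s : ℝ} (hs : 0 ≤ s) (K : Set Plane) :
    expProd (fun n => weight α s K (N.point n ω)) =
      ENNReal.ofReal (Real.exp (-(s * ∑' n, gainOutside α K (N.point n ω)))) := by
  rw [← tsum_mul_left]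
  exact expProd_ofReal_exp (fun n => mul_nonneg hs (gainOutside_nonneg _ _ _))
    ((h.summable_gainOutside K).mul_left s)

lemma tendsto_tsum_gainOutside (h : N.Regular α ω) {v : ℝ} {r : ℝ × ℝ} {R : ℕ → ℝ × ℝ}
    (hle : ∀ k, r ≤ R k) (hR : Tendsto R atTop (𝓝 r)) :
    Tendsto (fun k => ∑' n, gainOutside α (discs v (R k)) (N.point n ω)) atTop
      (𝓝 (∑' n, gainOutside α (discs v r) (N.point n ω))) := by
  refine tendsto_tsum_of_dominated_convergence h.summable (fun n => ?_)
    (Eventually.of_forall fun k n => ?_)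
  · refine tendsto_const_nhds.congr' ?_
    filter_upwards [eventually_mem_discs_iff (v := v) hle hR (N.point n ω).1] with k hk
    by_cases hx : (N.point n ω).1 ∈ discs v r
    · simp [gainOutside, indicator, hx, hk.2 hx]
    · have hx' : (N.point n ω).1 ∉ discs v (R k) := fun h => hx (hk.1 h)
      simp [gainOutside, indicator, hx, hx']
  · rw [Real.norm_of_nonneg (gainOutside_nonneg _ _ _)]
    exact gainOutside_le _ _ _

lemma tendsto_expProd_weight (h : N.Regular α ω) {s v : ℝ} (hs : 0 ≤ s) {r : ℝ × ℝ}
    {R : ℕ → ℝ × ℝ} (hle : ∀ k, r ≤ R k) (hR : Tendsto R atTop (𝓝 r)) :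
    Tendsto (fun k => expProd fun n => weight α s (discs v (R k)) (N.point n ω)) atTop
      (𝓝 (expProd fun n => weight α s (discs v r) (N.point n ω))) := by
  simp_rw [h.expProd_weight hs]
  exact (ENNReal.continuous_ofReal.tendsto _).comp ((Real.continuous_exp.tendsto _).comp
    ((h.tendsto_tsum_gainOutside hle hR).const_mul s).neg)

/-- The rounded distance minus `δ` lies below the true one, so `approxY` contains `Y`. Off `Y` the
nearest `A` is strictly closer than the nearest `B`, and a small mesh detects this gap. -/
lemma eventually_mem_approxY_iff (h : N.Regular α ω) (v : ℝ) {δ : ℕ → ℝ} (hδ : ∀ k, 0 < δ k)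
    (hlim : Tendsto δ atTop (𝓝 0)) :
    ∀ᶠ k in atTop, (ω ∈ N.approxY v (δ k) ↔ ω ∈ N.subcaseY v) := by
  have h0 : 0 ≤ (N.dists v ω).1 := N.fileDist_nonneg _ _ _
  by_cases hω : ω ∈ N.subcaseY v
  · refine Eventually.of_forall fun k => iff_of_true ?_ hω
    have h1 : (N.dists v ω).1 ≤ _ := h.mem_subcaseY_iff.1 hω
    have h2 := roundUp_lt (hδ k) h0
    exact (show roundUp (δ k) (N.dists v ω).1 - δ k < _ by linarith)
  · have h1 : N.fileDist FilePortion.A (loc1 v) ω < (N.dists v ω).1 :=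
      not_le.1 fun hle => hω (h.mem_subcaseY_iff.2 hle)
    have h2 : Tendsto (fun k => roundUp (δ k) (N.dists v ω).1 - δ k) atTop
        (𝓝 ((N.dists v ω).1 - 0)) := (tendsto_roundUp hδ hlim h0).sub hlim
    rw [sub_zero] at h2
    filter_upwards [h2.eventually_const_lt h1] with k hk
    exact iff_of_false (fun hk' => hk.not_gt hk') hω

/-- The limit of the discretized quantities, as the grid is refined. -/
lemma tendsto_indicator_approxY (h : N.Regular α ω) (v : ℝ) {δ : ℕ → ℝ} (hδ : ∀ k, 0 < δ k)
    (hlim : Tendsto δ atTop (𝓝 0)) (F : ℝ × ℝ → Ω → ℝ≥0∞)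
    (hF : ∀ R : ℕ → ℝ × ℝ, (∀ k, N.dists v ω ≤ R k) → Tendsto R atTop (𝓝 (N.dists v ω)) →
      Tendsto (fun k => F (R k) ω) atTop (𝓝 (F (N.dists v ω) ω))) :
    Tendsto (fun k => (N.approxY v (δ k)).indicator
        (fun ω => F (roundUp (δ k) (N.dists v ω).1, roundUp (δ k) (N.dists v ω).2) ω) ω) atTop
      (𝓝 ((N.subcaseY v).indicator (fun ω => F (N.dists v ω) ω) ω)) := by
  have hlim' := hF (fun k => (roundUp (δ k) (N.dists v ω).1, roundUp (δ k) (N.dists v ω).2))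
    (fun k => ⟨le_roundUp (hδ k) _, le_roundUp (hδ k) _⟩)
    ((tendsto_roundUp hδ hlim (N.fileDist_nonneg _ _ _)).prodMk_nhds
      (tendsto_roundUp hδ hlim (N.fileDist_nonneg _ _ _)))
  by_cases hω : ω ∈ N.subcaseY v
  · rw [indicator_of_mem hω]
    refine hlim'.congr' ?_
    filter_upwards [h.eventually_mem_approxY_iff v hδ hlim] with k hk
    rw [indicator_of_mem (hk.2 hω)]
  · rw [indicator_of_notMem hω]
    refine tendsto_const_nhds.congr' ?_
    filter_upwards [h.eventually_mem_approxY_iff v hδ hlim] with k hk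
    rw [indicator_of_notMem fun h => hω (hk.1 h)]

end Regular

variable [MeasurableSpace Ω] {P : Measure Ω} {lam : ℝ≥0} {p q : I}

namespace IsModel

lemma tendsto_setLIntegral_approxY (hN : N.IsModel P lam p q) {α : ℝ}
    (hreg : ∀ᵐ ω ∂P, N.Regular α ω) (v : ℝ) {δ : ℕ → ℝ} (hδ : ∀ k, 0 < δ k)
    (hlim : Tendsto δ atTop (𝓝 0)) {F : ℝ × ℝ → Ω → ℝ≥0∞} {C : ℝ≥0} (hC : ∀ r ω, F r ω ≤ C)
    (hm : ∀ R : Ω → ℝ × ℝ, Measurable R → Measurable fun ω => F (R ω) ω)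
    (hF : ∀ᵐ ω ∂P, ∀ R : ℕ → ℝ × ℝ, (∀ k, N.dists v ω ≤ R k) →
      Tendsto R atTop (𝓝 (N.dists v ω)) →
      Tendsto (fun k => F (R k) ω) atTop (𝓝 (F (N.dists v ω) ω))) :
    Tendsto (fun k => ∫⁻ ω in N.approxY v (δ k),
        F (roundUp (δ k) (N.dists v ω).1, roundUp (δ k) (N.dists v ω).2) ω ∂P) atTop
      (𝓝 (∫⁻ ω in N.subcaseY v, F (N.dists v ω) ω ∂P)) := by
  have := hN.iIndepFun_mark.isProbabilityMeasure
  have hround (k) : Measurable fun ω =>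
      (roundUp (δ k) (N.dists v ω).1, roundUp (δ k) (N.dists v ω).2) := by
    have hr (x : ℝ) : Measurable (roundUp x) :=
      (measurable_from_nat.comp (Nat.measurable_ceil.comp (measurable_id.div_const x))).mul_const x
    exact ((hr _).comp (hN.measurable_dists v).fst).prodMk
      ((hr _).comp (hN.measurable_dists v).snd)
  simp_rw [← lintegral_indicator (hN.measurableSet_approxY v _),
    ← lintegral_indicator (hN.measurableSet_subcaseY v)]
  refine tendsto_lintegral_of_dominated_convergence (fun _ => (C : ℝ≥0∞))
    (fun k => (hm _ (hround k)).indicator (hN.measurableSet_approxY v _))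
    (fun k => ae_of_all _ fun ω => (indicator_le_self' (fun _ _ => zero_le) ω).trans (hC _ _))
    (by simp) ?_
  filter_upwards [hreg, hF] with ω hω hFω
  exact hω.tendsto_indicator_approxY v hδ hlim F hFω

/-- In subcase `Y`, the Laplace transform of the interference, tested against functions of the two
distances. -/
theorem setLIntegral_subcaseY (hN : N.IsModel P lam p q) {α : ℝ} (hα : 2 < α)
    (hreg : ∀ᵐ ω ∂P, N.Regular α ω) (v : ℝ) {s : ℝ} (hs : 0 < s)
    (h : BoundedContinuousFunction (ℝ × ℝ) ℝ≥0) :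
    ∫⁻ ω in N.subcaseY v, h (N.dists v ω) *
        expProd (fun n => weight α s (discs v (N.dists v ω)) (N.point n ω)) ∂P =
      ∫⁻ ω in N.subcaseY v, h (N.dists v ω) *
        ENNReal.ofReal (laplaceOutside α s lam p q (discs v (N.dists v ω))) ∂P := by
  let δ : ℕ → ℝ := fun k => 1 / ((k : ℝ) + 1)
  have hδ (k) : 0 < δ k := by positivity
  have hlim : Tendsto δ atTop (𝓝 0) := tendsto_one_div_add_atTop_nhds_zero_nat
  have hle (r : ℝ × ℝ) : (h r : ℝ≥0∞) ≤ nndist h 0 :=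
    ENNReal.coe_le_coe.2 (BoundedContinuousFunction.NNReal.upper_bound h r)
  -- The test function is evaluated at rounded distances, so its continuity is what survives the
  -- refinement of the grid.
  have hcont (R : ℕ → ℝ × ℝ) (r) (hR : Tendsto R atTop (𝓝 r)) :
      Tendsto (fun k => (h (R k) : ℝ≥0∞)) atTop (𝓝 (h r : ℝ≥0∞)) :=
    ENNReal.tendsto_coe.2 ((h.continuous.tendsto _).comp hR)
  have hmeas : Measurable fun r => (h r : ℝ≥0∞) :=
    h.continuous.measurable.coe_nnreal_ennreal
  refine tendsto_nhds_unique
    (hN.tendsto_setLIntegral_approxY hreg v hδ hlim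
      (F := fun r ω => h r * expProd fun n => weight α s (discs v r) (N.point n ω))
      (C := nndist h 0) (fun r ω => (mul_le_of_le_one_right' (expProd_le_one _)).trans (hle r))
      (fun R hR => (hmeas.comp hR).mul (hN.measurable_expProd_weight α s v hR)) ?_)
    ((hN.tendsto_setLIntegral_approxY hreg v hδ hlim
      (F := fun r ω => h r * ENNReal.ofReal (laplaceOutside α s lam p q (discs v r)))
      (C := nndist h 0) (fun r ω => (mul_le_of_le_one_right' ?_).trans (hle r))
      (fun R hR => (hmeas.comp hR).mul
        ((measurable_laplaceOutside_discs α s v lam p q).comp hR).ennreal_ofReal) ?_).congr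
      fun k => ?_)
  · filter_upwards [hreg] with ω hω R hR1 hR2
    exact ENNReal.Tendsto.mul (hcont R _ hR2) (.inr
      ((expProd_le_one _).trans_lt ENNReal.one_lt_top).ne) (hω.tendsto_expProd_weight hs.le hR1 hR2)
      (.inr ENNReal.coe_ne_top)
  · exact ENNReal.ofReal_le_one.2 (laplaceOutside_le_one hs _ _ _ _)
  · refine ae_of_all _ fun ω R hR1 hR2 => ?_
    exact ENNReal.Tendsto.mul (hcont R _ hR2) (.inr ENNReal.ofReal_ne_top)
      ((ENNReal.continuous_ofReal.tendsto _).comp (tendsto_laplaceOutside hα hs lam p q hR1 hR2))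
      (.inr ENNReal.coe_ne_top)
  · exact (hN.setLIntegral_approxY hα hreg v (hδ k) hs fun r => h r).symm

end IsModel

end Network


/-! ### Conditional Laplace transforms -/

section CondLaplace

variable {Ω : Type*} [MeasurableSpace Ω] {μ : Measure Ω} [IsFiniteMeasure μ] {J : Ω → ℝ}
  {R : Ω → ℝ × ℝ}

/-- Weighting the law of `R` by `G`, or by the conditional Laplace transform, gives finite measures
with equal integrals of bounded continuous functions. The measures coincide, hence so do the
densities almost everywhere. -/
lemma condLaplace_ae_eq (hR : AEMeasurable R μ) (hJ : AEMeasurable J μ) {s : ℝ}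
    {G : ℝ × ℝ → ℝ} (hG : Measurable G) (hG0 : ∀ r, 0 ≤ G r) (hG1 : ∀ r, G r ≤ 1)
    (h : ∀ φ : BoundedContinuousFunction (ℝ × ℝ) ℝ≥0,
      ∫⁻ ω, φ (R ω) * ENNReal.ofReal (Real.exp (-s * J ω)) ∂μ =
        ∫⁻ ω, φ (R ω) * ENNReal.ofReal (G (R ω)) ∂μ) :
    ∀ᵐ r ∂(μ.map R), condLaplace μ J R s r = G r := by
  set ρ := μ.map R with hρ
  set κ := condDistrib J R μ with hκ
  have hexp : Measurable fun z : (ℝ × ℝ) × ℝ => ENNReal.ofReal (Real.exp (-s * z.2)) := by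
    fun_prop
  set L : ℝ × ℝ → ℝ≥0∞ := fun r => ∫⁻ x, ENNReal.ofReal (Real.exp (-s * x)) ∂(κ r) with hL
  have hLm : Measurable L := hexp.lintegral_kernel_prod_right'
  have hGm : Measurable fun r => ENNReal.ofReal (G r) := hG.ennreal_ofReal
  have hfin : IsFiniteMeasure (ρ.withDensity fun r => ENNReal.ofReal (G r)) :=
    isFiniteMeasure_withDensity (((lintegral_mono fun r =>
      ENNReal.ofReal_le_one.2 (hG1 r)).trans_lt (by simp)).ne)
  have heq : ρ.withDensity (fun r => ENNReal.ofReal (G r)) = ρ.withDensity L := by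
    refine ext_of_forall_lintegral_eq_of_IsFiniteMeasure fun φ => ?_
    have hφ : Measurable fun r => (φ r : ℝ≥0∞) := φ.continuous.measurable.coe_nnreal_ennreal
    rw [lintegral_withDensity_eq_lintegral_mul _ hGm hφ,
      lintegral_withDensity_eq_lintegral_mul _ hLm hφ]
    simp only [Pi.mul_apply]
    have hprod : Measurable fun z : (ℝ × ℝ) × ℝ =>
        (φ z.1 : ℝ≥0∞) * ENNReal.ofReal (Real.exp (-s * z.2)) :=
      (hφ.comp measurable_fst).mul hexp
    calc ∫⁻ r, ENNReal.ofReal (G r) * φ r ∂ρ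
        = ∫⁻ ω, φ (R ω) * ENNReal.ofReal (G (R ω)) ∂μ := by
          have hm : Measurable fun r => ENNReal.ofReal (G r) * φ r := hGm.mul hφ
          rw [lintegral_map' hm.aemeasurable hR]
          simp_rw [mul_comm]
      _ = ∫⁻ ω, φ (R ω) * ENNReal.ofReal (Real.exp (-s * J ω)) ∂μ := (h φ).symm
      _ = ∫⁻ z, φ z.1 * ENNReal.ofReal (Real.exp (-s * z.2)) ∂(ρ ⊗ₘ κ) := by
          rw [compProd_map_condDistrib hJ, lintegral_map' hprod.aemeasurable (hR.prodMk hJ)]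
      _ = ∫⁻ r, L r * φ r ∂ρ := by
          rw [Measure.lintegral_compProd hprod]
          refine lintegral_congr fun r => ?_
          dsimp only
          rw [lintegral_const_mul _ (by fun_prop), mul_comm]
  filter_upwards [(withDensity_eq_iff_of_sigmaFinite hGm.aemeasurable hLm.aemeasurable).1 heq]
    with r hr
  rw [condLaplace, integral_eq_lintegral_of_nonneg_ae (ae_of_all _ fun x => (Real.exp_pos _).le)
    (by fun_prop)]
  rw [show ∫⁻ x, ENNReal.ofReal (Real.exp (-s * x)) ∂(condDistrib J R μ r) =
    ENNReal.ofReal (G r) from hr.symm, ENNReal.toReal_ofReal (hG0 r)]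

lemma ae_condDistrib_nonneg (hR : AEMeasurable R μ) (hJ : AEMeasurable J μ)
    (hJ0 : ∀ᵐ ω ∂μ, 0 ≤ J ω) : ∀ᵐ r ∂(μ.map R), ∀ᵐ x ∂(condDistrib J R μ r), 0 ≤ x := by
  refine Measure.ae_ae_of_ae_compProd (p := fun z : (ℝ × ℝ) × ℝ => 0 ≤ z.2) ?_
  rw [compProd_map_condDistrib hJ]
  exact (ae_map_iff (hR.prodMk hJ) (measurableSet_le measurable_const measurable_snd)).2 hJ0

lemma tendsto_condLaplace {r : ℝ × ℝ} (hr : ∀ᵐ x ∂(condDistrib J R μ r), 0 ≤ x) {s : ℝ}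
    (hs : 0 < s) {u : ℕ → ℝ} (hu : ∀ n, s < u n) (hlim : Tendsto u atTop (𝓝 s)) :
    Tendsto (fun n => condLaplace μ J R (u n) r) atTop (𝓝 (condLaplace μ J R s r)) := by
  refine tendsto_integral_of_dominated_convergence (fun _ => 1) (fun n => by fun_prop)
    (integrable_const _) (fun n => ?_) (ae_of_all _ fun x => ?_)
  · filter_upwards [hr] with x hx
    rw [Real.norm_of_nonneg (Real.exp_pos _).le, Real.exp_le_one_iff]
    nlinarith [mul_nonneg (hs.trans (hu n)).le hx]
  · exact (Real.continuous_exp.tendsto _).comp (hlim.neg.mul_const x)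

/-- A criterion for the Laplace transform of a conditional distribution, for all arguments
simultaneously. -/
theorem condLaplace_ae_eq_forall (hR : AEMeasurable R μ) (hJ : AEMeasurable J μ)
    (hJ0 : ∀ᵐ ω ∂μ, 0 ≤ J ω) {G : ℝ → ℝ × ℝ → ℝ} (hG : ∀ s, Measurable (G s))
    (hG0 : ∀ s r, 0 ≤ G s r) (hG1 : ∀ s r, 0 < s → G s r ≤ 1)
    (hGlim : ∀ s, 0 < s → ∀ u : ℕ → ℝ, (∀ n, s < u n) → Tendsto u atTop (𝓝 s) →
      ∀ r, Tendsto (fun n => G (u n) r) atTop (𝓝 (G s r)))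
    (h : ∀ s, 0 < s → ∀ φ : BoundedContinuousFunction (ℝ × ℝ) ℝ≥0,
      ∫⁻ ω, φ (R ω) * ENNReal.ofReal (Real.exp (-s * J ω)) ∂μ =
        ∫⁻ ω, φ (R ω) * ENNReal.ofReal (G s (R ω)) ∂μ) :
    ∀ᵐ r ∂(μ.map R), ∀ s, 0 < s → condLaplace μ J R s r = G s r := by
  -- The exceptional null set depends on the argument. It is collected over the rationals, and any
  -- `s` is then reached by rationals decreasing to it.
  have hrat : ∀ᵐ r ∂(μ.map R), ∀ t : ℚ, 0 < (t : ℝ) → condLaplace μ J R t r = G t r :=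
    ae_all_iff.2 fun t => eventually_imp_distrib_left.2 fun ht =>
      condLaplace_ae_eq hR hJ (hG t) (hG0 t) (fun r => hG1 t r ht) (h t ht)
  filter_upwards [hrat, ae_condDistrib_nonneg hR hJ hJ0] with r hr hr0 s hs
  obtain ⟨u, -, hu, hlim⟩ := Real.exists_seq_rat_strictAnti_tendsto s
  refine tendsto_nhds_unique (tendsto_condLaplace hr0 hs (u := fun n => (u n : ℝ)) hu hlim) ?_
  refine (hGlim s hs (fun n => (u n : ℝ)) hu hlim r).congr fun n => ?_
  exact (hr (u n) (hs.trans (hu n))).symm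

end CondLaplace

lemma tendsto_laplaceOutside_arg {α s : ℝ} (hα : 2 < α) (hs : 0 < s) (lam : ℝ≥0) (p q : I)
    (K : Set Plane) {u : ℕ → ℝ} (hu : ∀ n, s < u n) (hlim : Tendsto u atTop (𝓝 s)) :
    Tendsto (fun n => laplaceOutside α (u n) lam p q K) atTop
      (𝓝 (laplaceOutside α s lam p q K)) := by
  refine (Real.continuous_exp.tendsto _).comp (Tendsto.neg (Tendsto.const_mul _ ?_))
  -- `pathLoss` increases with its argument and `u n` is eventually below s + 1, hence the
  -- dominating function.
  refine tendsto_integral_filter_of_dominated_convergence (pathLoss α (s + 1))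
    (Eventually.of_forall fun n => (measurable_pathLoss α _).aestronglyMeasurable) ?_
    (integrable_pathLoss hα (by linarith)).integrableOn (ae_of_all _ fun x => ?_)
  · filter_upwards [hlim.eventually_lt_const (show s < s + 1 by linarith)] with n hn
    refine ae_of_all _ fun x => ?_
    rw [Real.norm_of_nonneg (pathLoss_nonneg (hs.trans (hu n)) x)]
    exact pathLoss_mono (hs.trans (hu n)) hn.le x
  · unfold pathLoss
    have h1 : 1 + ‖x‖ ^ α / s ≠ 0 := by positivity
    exact tendsto_const_nhds.div ((tendsto_const_nhds.div hlim hs.ne').const_add 1) h1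

/-! ### The conditional law of `I₃` in subcase `Y` -/

namespace Network

variable {Ω : Type*} {N : Network Ω}

lemma Regular.I3term_eq {α v : ℝ} {ω : Ω} (h : N.Regular α ω) (hY : ω ∈ N.subcaseY v) (n : ℕ) :
    N.I3term α v ω n = gainOutside α (discs v (N.dists v ω)) (N.point n ω) := by
  have hK : Metric.closedBall (loc1 v) (N.R1 v ω) ∪ Metric.closedBall 0 (N.R2 ω) =
      discs v (N.dists v ω) := by
    rw [R1_eq_fileDist hY]
    rfl
  unfold I3term interferersA
  rw [hK]
  by_cases h1 : N.file n ω = FilePortion.A <;>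
    by_cases h2 : N.location n ω ∈ discs v (N.dists v ω) <;>
    simp [gainOutside, gain, indicator, point, mark, h1, h2, abs_of_nonneg (h.nonneg n)]

variable [MeasurableSpace Ω] {P : Measure Ω} {lam : ℝ≥0} {p q : I}

namespace IsModel

lemma ae_cond_subcaseY (hN : N.IsModel P lam p q) {α : ℝ}
    (hreg : ∀ᵐ ω ∂P, N.Regular α ω) (v : ℝ) :
    ∀ᵐ ω ∂P[|N.subcaseY v], N.Regular α ω ∧ ω ∈ N.subcaseY v := by
  filter_upwards [ProbabilityTheory.cond_absolutelyContinuous.ae_le hreg,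
    ae_cond_mem (hN.measurableSet_subcaseY v)] with ω h1 h2 using ⟨h1, h2⟩

/-- The conditional Laplace transform of the interference in terms of planar integrals. -/
theorem condLaplace_I3 (hN : N.IsModel P lam p q) {α : ℝ} (hα : 2 < α)
    (hreg : ∀ᵐ ω ∂P, N.Regular α ω) (v : ℝ) :
    ∀ᵐ r ∂((P[|N.subcaseY v]).map fun ω => (N.R1 v ω, N.R2 ω)), ∀ s : ℝ, 0 < s →
      condLaplace (P[|N.subcaseY v]) (N.I3 α v) (fun ω => (N.R1 v ω, N.R2 ω)) s r =
        laplaceOutside α s lam p q (discs v r) := by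
  have := hN.iIndepFun_mark.isProbabilityMeasure
  have hae := hN.ae_cond_subcaseY hreg v
  have hReq : (fun ω => (N.R1 v ω, N.R2 ω)) =ᵐ[P[|N.subcaseY v]] N.dists v := by
    filter_upwards [hae] with ω hω
    rw [R1_eq_fileDist hω.2]
    rfl
  have hI3 : ∀ᵐ ω ∂P[|N.subcaseY v], ∀ s : ℝ, 0 < s → ENNReal.ofReal (Real.exp (-s * N.I3 α v ω)) =
      expProd fun n => weight α s (discs v (N.dists v ω)) (N.point n ω) := by
    filter_upwards [hae] with ω hω s hs
    rw [hω.1.expProd_weight hs.le, I3, tsum_congr (hω.1.I3term_eq hω.2), neg_mul]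
  -- `I3` is recovered almost surely as minus the logarithm of the measurable product at s = 1.
  have hJ : AEMeasurable (N.I3 α v) (P[|N.subcaseY v]) := by
    refine ⟨fun ω => -Real.log (expProd fun n => weight α 1 (discs v (N.dists v ω))
      (N.point n ω)).toReal, ((hN.measurable_expProd_weight α 1 v
        (hN.measurable_dists v)).ennreal_toReal.log).neg, ?_⟩
    filter_upwards [hI3] with ω hω
    rw [← hω 1 one_pos, ENNReal.toReal_ofReal (Real.exp_pos _).le, Real.log_exp]
    ring
  have hJ0 : ∀ᵐ ω ∂P[|N.subcaseY v], 0 ≤ N.I3 α v ω := by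
    filter_upwards [hae] with ω hω
    refine tsum_nonneg fun n => ?_
    rw [hω.1.I3term_eq hω.2]
    exact gainOutside_nonneg _ _ _
  refine condLaplace_ae_eq_forall ((hN.measurable_dists v).aemeasurable.congr hReq.symm) hJ hJ0
    (G := fun s r => laplaceOutside α s lam p q (discs v r))
    (fun s => measurable_laplaceOutside_discs α s v lam p q)
    (fun s r => (Real.exp_pos _).le) (fun s r hs => laplaceOutside_le_one hs _ _ _ _)
    (fun s hs u hu hlim r => tendsto_laplaceOutside_arg hα hs lam p q _ hu hlim)
    fun s hs φ => ?_
  refine Eq.trans (lintegral_congr_ae (g := fun ω => φ (N.dists v ω) *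
      expProd fun n => weight α s (discs v (N.dists v ω)) (N.point n ω)) ?_)
    (Eq.trans ?_ (lintegral_congr_ae (f := fun ω => φ (N.dists v ω) *
      ENNReal.ofReal (laplaceOutside α s lam p q (discs v (N.dists v ω)))) ?_))
  · filter_upwards [hReq, hI3] with ω hω hω'
    rw [show (N.R1 v ω, N.R2 ω) = N.dists v ω from hω, hω' s hs]
  · rw [ProbabilityTheory.cond, lintegral_smul_measure, lintegral_smul_measure,
      hN.setLIntegral_subcaseY hα hreg v hs φ]
  · filter_upwards [hReq] with ω hω
    rw [show (N.R1 v ω, N.R2 ω) = N.dists v ω from hω]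

/-- The distances in subcase `Y` are nonnegative, and ordered if the two locations agree. -/
lemma ae_map_dists (hN : N.IsModel P lam p q) {α : ℝ} (hreg : ∀ᵐ ω ∂P, N.Regular α ω) (v : ℝ) :
    ∀ᵐ r ∂((P[|N.subcaseY v]).map fun ω => (N.R1 v ω, N.R2 ω)),
      0 ≤ r.1 ∧ 0 ≤ r.2 ∧ (v = 0 → r.1 ≤ r.2) := by
  have hae := hN.ae_cond_subcaseY hreg v
  have hReq : (fun ω => (N.R1 v ω, N.R2 ω)) =ᵐ[P[|N.subcaseY v]] N.dists v := by
    filter_upwards [hae] with ω hω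
    rw [R1_eq_fileDist hω.2]
    rfl
  have hmeas : MeasurableSet {r : ℝ × ℝ | 0 ≤ r.1 ∧ 0 ≤ r.2 ∧ (v = 0 → r.1 ≤ r.2)} :=
    (measurableSet_le measurable_const measurable_fst).inter
      ((measurableSet_le measurable_const measurable_snd).inter
        (.imp (.const _) (measurableSet_le measurable_fst measurable_snd)))
  refine (ae_map_iff ((hN.measurable_dists v).aemeasurable.congr hReq.symm) hmeas).2 ?_
  filter_upwards [hae, hReq] with ω hω hR
  change 0 ≤ (N.R1 v ω, N.R2 ω).1 ∧ 0 ≤ (N.R1 v ω, N.R2 ω).2 ∧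
    (v = 0 → (N.R1 v ω, N.R2 ω).1 ≤ (N.R1 v ω, N.R2 ω).2)
  rw [show (N.R1 v ω, N.R2 ω) = N.dists v ω from hR]
  refine ⟨N.fileDist_nonneg _ _ _, N.fileDist_nonneg _ _ _, ?_⟩
  rintro rfl
  have h0 : loc1 0 = 0 := by
    ext i
    fin_cases i <;> simp [loc1]
  have := hω.1.mem_subcaseY_iff.1 hω.2
  simpa only [dists, h0] using this

end IsModel

end Network


/-! ### Planar integrals in polar coordinates -/

/-- The point of the plane with polar coordinates `r` and `θ`. -/
noncomputable def polarPoint (r θ : ℝ) : Plane := !₂[r * Real.cos θ, r * Real.sin θ]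

lemma norm_polarPoint {r : ℝ} (hr : 0 ≤ r) (θ : ℝ) : ‖polarPoint r θ‖ = r := by
  rw [EuclideanSpace.norm_eq, Fin.sum_univ_two, ← Real.sqrt_sq hr]
  congr 1
  simp only [polarPoint, Real.norm_eq_abs, sq_abs]
  simp only [Matrix.cons_val_zero, Matrix.cons_val_one, Real.sqrt_sq hr]
  linear_combination r ^ 2 * Real.sin_sq_add_cos_sq θ

lemma lintegral_plane_eq_polar {g : Plane → ℝ≥0∞} (hg : Measurable g) :
    ∫⁻ x, g x = ∫⁻ r in Ioi (0 : ℝ), ∫⁻ θ in Ioo (-Real.pi) Real.pi,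
      ENNReal.ofReal r * g (polarPoint r θ) := by
  have hmp : MeasurePreserving fun z : ℝ × ℝ => (!₂[z.1, z.2] : Plane) :=
    (PiLp.volume_preserving_toLp (Fin 2)).comp (volume_preserving_finTwoArrow ℝ).symm
  have hpp : Measurable fun z : ℝ × ℝ => polarPoint z.1 z.2 :=
    hmp.measurable.comp (g := fun z : ℝ × ℝ => (!₂[z.1, z.2] : Plane))
      (f := fun z : ℝ × ℝ => (z.1 * Real.cos z.2, z.1 * Real.sin z.2)) (by fun_prop)
  rw [← hmp.lintegral_comp hg, ← lintegral_comp_polarCoord_symm, polarCoord_target,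
    Measure.volume_eq_prod, ← Measure.prod_restrict, lintegral_prod]
  · rfl
  · exact ((measurable_fst.ennreal_ofReal).mul (hg.comp hpp)).aemeasurable

/-- The path loss is radial, so the angular integral only sees the angular measure `A r` of `S` on
the circle of radius `r`. -/
lemma setIntegral_pathLoss_eq_polar {α s : ℝ} (hs : 0 < s) {S : Set Plane} (hS : MeasurableSet S)
    {b : ℝ} (hb : 0 ≤ b) (hSb : ∀ x ∈ S, b < ‖x‖) {A : ℝ → ℝ} (hA : Measurable A)
    (hA0 : ∀ r, 0 ≤ A r)
    (hSA : ∀ r, b < r → volume ({θ | polarPoint r θ ∈ S} ∩ Ioo (-Real.pi) Real.pi) =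
      ENNReal.ofReal (A r)) :
    ∫ x in S, pathLoss α s x = ∫ r in Ioi b, A r * r / (1 + r ^ α / s) := by
  rw [integral_eq_lintegral_of_nonneg_ae (ae_of_all _ fun x => pathLoss_nonneg hs x)
      (measurable_pathLoss α s).aestronglyMeasurable,
    integral_eq_lintegral_of_nonneg_ae]
  rotate_left
  · filter_upwards [self_mem_ae_restrict measurableSet_Ioi] with r hr
    have hr0 : 0 < r := hb.trans_lt hr
    exact div_nonneg (mul_nonneg (hA0 r) hr0.le) (by positivity)
  · exact Measurable.aestronglyMeasurable (by fun_prop)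
  congr 1
  rw [← lintegral_indicator hS, lintegral_plane_eq_polar
    ((measurable_pathLoss α s).ennreal_ofReal.indicator hS),
    ← lintegral_indicator measurableSet_Ioi, ← lintegral_indicator measurableSet_Ioi]
  refine lintegral_congr fun r => ?_
  by_cases hr : 0 < r
  swap
  · rw [indicator_of_notMem (by exact hr), 
      indicator_of_notMem (show r ∉ Ioi b from fun h => hr (hb.trans_lt h))]
  rw [indicator_of_mem (by exact hr)]
  by_cases hbr : b < r
  · rw [indicator_of_mem (by exact hbr)]
    have hmeas : MeasurableSet {θ | polarPoint r θ ∈ S} := by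
      refine hS.preimage ?_
      have : Continuous fun θ => polarPoint r θ := by unfold polarPoint; fun_prop
      exact this.measurable
    have heq (θ : ℝ) : ENNReal.ofReal r *
        S.indicator (fun x => ENNReal.ofReal (pathLoss α s x)) (polarPoint r θ) =
        {θ | polarPoint r θ ∈ S}.indicator
          (fun _ => ENNReal.ofReal (r / (1 + r ^ α / s))) θ := by
      by_cases hθ : polarPoint r θ ∈ S
      · rw [indicator_of_mem hθ, indicator_of_mem (by exact hθ), ← ENNReal.ofReal_mul hr.le,
          pathLoss, norm_polarPoint hr.le, mul_one_div]
      · rw [indicator_of_notMem hθ, indicator_of_notMem (by exact hθ), mul_zero]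
    simp_rw [heq]
    rw [lintegral_indicator hmeas, setLIntegral_const, Measure.restrict_apply hmeas, hSA r hbr,
      ← ENNReal.ofReal_mul (by positivity)]
    congr 1
    ring
  · rw [indicator_of_notMem (by exact hbr)]
    refine (lintegral_congr fun θ => ?_).trans lintegral_zero
    rw [indicator_of_notMem fun h => hbr ?_, mul_zero]
    have := hSb _ h
    rwa [norm_polarPoint hr.le] at this

/-- `Real.arccos` is clamped outside [-1, 1]. The equivalence survives there, which covers circles
that `C₁` misses or contains entirely. -/
lemma lt_arccos_iff_lt_cos {x θ : ℝ} (hθ0 : 0 ≤ θ) (hθ : θ < Real.pi) :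
    θ < Real.arccos x ↔ x < Real.cos θ := by
  rcases lt_or_ge x (-1) with hx | hx
  · rw [Real.arccos_of_le_neg_one hx.le]
    exact iff_of_true hθ (hx.trans_le (Real.neg_one_le_cos θ))
  rcases lt_or_ge 1 x with hx1 | hx1
  · rw [Real.arccos_of_one_le hx1.le]
    exact iff_of_false hθ0.not_gt ((Real.cos_le_one θ).trans_lt hx1).not_gt
  · have := Real.strictAntiOn_cos.lt_iff_gt (a := Real.arccos x) (b := θ)
      ⟨Real.arccos_nonneg x, Real.arccos_le_pi x⟩ ⟨hθ0, hθ.le⟩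
    rw [Real.cos_arccos hx hx1] at this
    exact this.symm

/-- The law of cosines; the minus sign appears because the centre (-v, 0) lies in the direction of
angle π. -/
lemma polarPoint_mem_closedBall_iff {v r r1 : ℝ} (hv : 0 < v) (hr : 0 < r) (hr1 : 0 ≤ r1)
    (θ : ℝ) : polarPoint r θ ∈ Metric.closedBall (Network.loc1 v) r1 ↔
      Real.cos θ ≤ -((r ^ 2 + v ^ 2 - r1 ^ 2) / (2 * r * v)) := by
  rw [Metric.mem_closedBall, EuclideanSpace.dist_eq, Fin.sum_univ_two, Real.sqrt_le_left hr1,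
    le_neg, div_le_iff₀ (by positivity)]
  simp only [polarPoint, Network.loc1, Real.dist_eq, sq_abs, PiLp.toLp_apply,
    Matrix.cons_val_zero, Matrix.cons_val_one]
  have h : (r * Real.cos θ - -v) ^ 2 + (r * Real.sin θ - 0) ^ 2 =
      r ^ 2 + v ^ 2 + 2 * r * v * Real.cos θ := by
    linear_combination r ^ 2 * Real.sin_sq_add_cos_sq θ
  rw [h]
  constructor <;> intro h' <;> linarith

/-- The arc is centred at angle π, so in (-π, π) it is the complement of (-β, β) with β = π - f, and
its length is 2π - 2β = 2f. -/
lemma volume_arc {v r r1 : ℝ} (hv : 0 < v) (hr : 0 < r) (hr1 : 0 ≤ r1) :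
    volume ({θ | polarPoint r θ ∈ Metric.closedBall (Network.loc1 v) r1} ∩
      Ioo (-Real.pi) Real.pi) = ENNReal.ofReal (2 * f v r r1) := by
  set c := (r ^ 2 + v ^ 2 - r1 ^ 2) / (2 * r * v) with hc
  set β := Real.arccos (-c) with hβ
  have hβ0 : 0 ≤ β := Real.arccos_nonneg _
  have hβπ : β ≤ Real.pi := Real.arccos_le_pi _
  have hset : {θ | polarPoint r θ ∈ Metric.closedBall (Network.loc1 v) r1} ∩
      Ioo (-Real.pi) Real.pi = Ioo (-Real.pi) Real.pi \ Ioo (-β) β := by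
    ext θ
    rw [inter_comm]
    refine and_congr_right fun hθ => ?_
    have h := lt_arccos_iff_lt_cos (x := -c) (abs_nonneg θ) (abs_lt.2 ⟨hθ.1, hθ.2⟩)
    rw [Real.cos_abs, abs_lt] at h
    rw [mem_ofPred_eq, polarPoint_mem_closedBall_iff hv hr hr1, ← not_lt]
    exact not_congr h.symm
  rw [hset, measure_sdiff (Ioo_subset_Ioo (by linarith) hβπ) measurableSet_Ioo.nullMeasurableSet
    (by simp), Real.volume_Ioo, Real.volume_Ioo, ← ENNReal.ofReal_sub _ (by linarith)]
  congr 1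
  rw [hβ, Real.arccos_neg, f]
  ring

lemma f_eq_zero {v r r1 : ℝ} (hv : 0 < v) (hr : 0 < r) (h : r1 ^ 2 ≤ (r - v) ^ 2) :
    f v r r1 = 0 := by
  rw [f, Real.arccos_eq_zero, le_div_iff₀ (by positivity)]
  linarith

lemma setIntegral_compl_closedBall {α s : ℝ} (hs : 0 < s) {b : ℝ} (hb : 0 ≤ b) :
    ∫ x in (Metric.closedBall (0 : Plane) b)ᶜ, pathLoss α s x =
      ∫ r in Ioi b, 2 * Real.pi * r / (1 + r ^ α / s) := by
  refine setIntegral_pathLoss_eq_polar hs Metric.isClosed_closedBall.measurableSet.compl hb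
    (fun x hx => ?_) measurable_const (fun _ => by positivity) fun r hr => ?_
  · simpa using hx
  · have hr0 : 0 ≤ r := hb.trans hr.le
    have : {θ | polarPoint r θ ∈ (Metric.closedBall (0 : Plane) b)ᶜ} = univ := by
      ext θ
      simpa [norm_polarPoint hr0] using hr
    rw [this, univ_inter, Real.volume_Ioo]
    congr 1
    ring

lemma setIntegral_closedBall_diff {α s v r1 r2 : ℝ} (hs : 0 < s) (hv : 0 < v) (hr1 : 0 ≤ r1)
    (hr2 : 0 ≤ r2) :
    ∫ x in Metric.closedBall (Network.loc1 v) r1 \ Metric.closedBall 0 r2, pathLoss α s x =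
      ∫ r in Ioi r2, 2 * f v r r1 * r / (1 + r ^ α / s) := by
  refine setIntegral_pathLoss_eq_polar hs (Metric.isClosed_closedBall.measurableSet.diff
    Metric.isClosed_closedBall.measurableSet) hr2 (fun x hx => ?_) ?_
    (fun _ => mul_nonneg zero_le_two (Real.arccos_nonneg _)) fun r hr => ?_
  · simpa using hx.2
  · unfold f
    exact (Real.continuous_arccos.measurable.comp (by fun_prop)).const_mul 2
  · have hr0 : 0 < r := hr2.trans_lt hr
    rw [← volume_arc hv hr0 hr1]
    congr 2
    ext θ
    have : r2 < ‖polarPoint r θ‖ := by rwa [norm_polarPoint hr0.le]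
    simp [this]

/-- The integrand vanishes where |r - v| ≥ r₁. The three cases of `calB` tell whether r₂ lies at or
below v - r₁, strictly between v - r₁ and v + r₁, or at or beyond v + r₁. -/
lemma setIntegral_eq_calB {α s v r1 r2 : ℝ} (hv : 0 < v) (hr1 : 0 ≤ r1) (hr2 : 0 ≤ r2) :
    ∫ r in Ioi r2, 2 * f v r r1 * r / (1 + r ^ α / s) = calB α s r1 r2 v := by
  have hf0 {r : ℝ} (hr : r2 < r) (h : r ≤ v - r1 ∨ v + r1 ≤ r) : f v r r1 = 0 := by
    refine f_eq_zero hv (hr2.trans_lt hr) ?_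
    rcases h with h | h <;> nlinarith
  rw [calB]
  split_ifs with h1 h2
  · rw [intervalIntegral.integral_of_le (by linarith)]
    refine setIntegral_eq_of_subset_of_forall_sdiff_eq_zero measurableSet_Ioi
      (fun r hr => lt_of_le_of_lt (by linarith) hr.1) fun r hr => ?_
    rw [hf0 hr.1, mul_zero, zero_mul, zero_div]
    by_contra! hcon
    exact hr.2 ⟨hcon.1, hcon.2.le⟩
  · rw [intervalIntegral.integral_of_le (by linarith)]
    refine setIntegral_eq_of_subset_of_forall_sdiff_eq_zero measurableSet_Ioi
      (fun r hr => hr.1) fun r hr => ?_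
    rw [hf0 hr.1 (.inr ?_), mul_zero, zero_mul, zero_div]
    by_contra! hcon
    exact hr.2 ⟨hr.1, hcon.le⟩
  · refine setIntegral_eq_zero_of_forall_eq_zero fun r hr => ?_
    have : r2 < r := hr
    rw [hf0 hr (.inr (by linarith)), mul_zero, zero_mul, zero_div]

lemma setIntegral_compl_discs {α s v : ℝ} (hα : 2 < α) (hs : 0 < s) (hv : 0 ≤ v) {r : ℝ × ℝ}
    (hr1 : 0 ≤ r.1) (hr2 : 0 ≤ r.2) (hr : v = 0 → r.1 ≤ r.2) :
    ∫ x in (discs v r)ᶜ, pathLoss α s x =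
      (∫ x in Ioi r.2, 2 * Real.pi * x / (1 + x ^ α / s)) - calB α s r.1 r.2 v := by
  have hint := integrable_pathLoss hα hs
  rcases hv.eq_or_lt with rfl | hv
  -- For v = 0 the discs are concentric with `C₁` inside `C₂`. This case is separate because `f`
  -- divides by `v`; the first branch of `calB` then forces r₁ = 0, an integral over a point.
  · have h12 := hr rfl
    have h0 : Network.loc1 0 = 0 := by
      ext i
      fin_cases i <;> simp [Network.loc1]
    have hB : calB α s r.1 r.2 0 = 0 := by
      rw [calB]
      split_ifs with h1 h2
      · rw [show r.1 = 0 by linarith, sub_zero, add_zero, intervalIntegral.integral_same]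
      · linarith
      · rfl
    rw [hB, sub_zero, ← setIntegral_compl_closedBall hs hr2, discs, h0,
      union_eq_self_of_subset_left (Metric.closedBall_subset_closedBall h12)]
  · have hset : (discs v r)ᶜ = (Metric.closedBall 0 r.2)ᶜ \
        (Metric.closedBall (Network.loc1 v) r.1 \ Metric.closedBall 0 r.2) := by
      ext x
      simp only [discs, mem_compl_iff, mem_union, Set.mem_sdiff]
      tauto
    have hsub : Metric.closedBall (Network.loc1 v) r.1 \ Metric.closedBall 0 r.2 ⊆
        (Metric.closedBall 0 r.2)ᶜ := fun x hx => hx.2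
    rw [hset, setIntegral_sdiff (Metric.isClosed_closedBall.measurableSet.diff
      Metric.isClosed_closedBall.measurableSet) hint.integrableOn hsub,
      setIntegral_compl_closedBall hs hr2, setIntegral_closedBall_diff hs hv hr1 hr2,
      setIntegral_eq_calB hv hr1 hr2]

lemma laplaceOutside_discs {α s v : ℝ} (hα : 2 < α) (hs : 0 < s) (hv : 0 ≤ v) (lam : ℝ≥0)
    (p q : I) {r : ℝ × ℝ} (hr1 : 0 ≤ r.1) (hr2 : 0 ≤ r.2) (hr : v = 0 → r.1 ≤ r.2) :
    laplaceOutside α s lam p q (discs v r) =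
      Real.exp (-((p : ℝ) * q * lam *
          ∫ x in Ioi r.2, 2 * Real.pi * x / (1 + x ^ α / s))) *
        Real.exp ((p : ℝ) * q * lam * calB α s r.1 r.2 v) := by
  rw [laplaceOutside, setIntegral_compl_discs hα hs hv hr1 hr2 hr, ← Real.exp_add]
  congr 1
  ring

end D2DCaching

theorem lemma4 {Ω : Type*} [MeasurableSpace Ω] (P : Measure Ω) [IsProbabilityMeasure P]
    (lam : ℝ≥0) (hlam : 0 < lam) (p q : unitInterval) (hp0 : 0 < p) (hp1 : p < 1)
    (α : ℝ) (hα : 2 < α) (v : ℝ) (hv : 0 ≤ v)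
    (N : D2DCaching.Network Ω) (hN : N.IsModel P lam p q) :
    (∀ᵐ ω ∂P[|N.subcaseY v], Summable (N.I3term α v ω)) ∧
    ∀ᵐ r ∂((P[|N.subcaseY v]).map fun ω => (N.R1 v ω, N.R2 ω)), ∀ s : ℝ, 0 < s →
      D2DCaching.condLaplace (P[|N.subcaseY v]) (N.I3 α v) (fun ω => (N.R1 v ω, N.R2 ω)) s r =
        Real.exp (-((p : ℝ) * q * lam *
            ∫ x in Ioi r.2, 2 * Real.pi * x / (1 + x ^ α / s))) *
          Real.exp ((p : ℝ) * q * lam * D2DCaching.calB α s r.1 r.2 v) := by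
  have hreg := hN.ae_regular hlam hp0 hp1 hα
  refine ⟨?_, ?_⟩
  · filter_upwards [hN.ae_cond_subcaseY hreg v] with ω hω
    exact (hω.1.summable_gainOutside _).congr fun n => (hω.1.I3term_eq hω.2 n).symm
  · filter_upwards [hN.condLaplace_I3 hα hreg v, hN.ae_map_dists hreg v] with r hr hr0 s hs
    rw [hr s hs, D2DCaching.laplaceOutside_discs hα hs hv lam p q hr0.1 hr0.2.1 hr0.2.2]
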